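/- **Definitions.** For probability measures $U,V$ on a common measurable space, the trade-off function is $T(U,V)(\alpha)=\inf\{1-\mathbb E_V[\phi] : \phi \text{ measurable},\ 0\le\phi\le 1,\ \mathbb E_U[\phi]\le\alpha\}$, $\alpha\in[0,1]$, and $G_\mu=T(N(0,1),N(\mu,1))$, i.e. $G_\mu(\alpha)=\Phi(\Phi^{-1}(1-\alpha)-\mu)$. A mechanism $M$ is $\mu$-GDP if $T(M(X_0),M(X_1))\ge G_\mu$ on $[0,1]$ for all neighbouring datasets $X_0,X_1$ (datasets of the same size that differ in exactly one record). Let $\mathcal D$ be a set and $\mathcal S^{(1)},\dots,\mathcal S^{(n)}$ measurable spaces. An $\epsilon_0$-LDP adaptive process is a sequence of randomizers $\mathcal R^{(i)}:\mathcal S^{(1)}\times\cdots\times\mathcal S^{(i-1)}\times\mathcal D\to\mathcal S^{(i)}$, $i=1,\dots,n$ (for each record, a Markov kernel in the previous outputs) such that $\mathbb P(\mathcal R^{(i)}(z_{1:i-1},x)\in E)\le e^{\epsilon_0}\,\mathbb P(\mathcal R^{(i)}(z_{1:i-1},x')\in E)$ for all $i$, $z_{1:i-1}$, $x,x'\in\mathcal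 D$ and measurable $E$. The shuffled process $\mathcal A_{R,S}$ takes a dataset $x_{1:n}\in\mathcal D^n$, draws a uniformly random permutation $\pi$ of $\{1,\dots,n\}$, computes successively $z_i=\mathcal R^{(i)}(z_{1:i-1},x_{\pi(i)})$, and outputs $z_{1:n}$. **Theorem 2.** Let $\epsilon_0>0$, $p=e^{-\epsilon_0}$ and $\mu_n=\dfrac{2e^{\epsilon_0/2}}{\sqrt{n-1}}$ for $n\ge 2$. 1. As $n\to\infty$, the shuffled $\epsilon_0$-LDP adaptive process is asymptotically $\mu_n$-GDP, with an error that is negligible compared with $\mu_n$: there is a sequence $\delta_n=o(\mu_n)=o(n^{-1/2})$, depending only on $\epsilon_0$, such that for every $n\ge2$, every domain $\mathcal D$, every $\epsilon_0$-LDP adaptive process of length $n$ on $\mathcal D$, all neighbouring datasets $X_0,X_1\in\mathcal D^n$ and all $\alpha\in[0,1]$, $$T\big(\mathcal A_{R,S}(X_0),\mathcal A_{R,S}(X_1)\big)(\alpha)\ \ge\ G_{\mu_n}(\alpha)-\delta_n .$$ 2. For every $n\ge2$ let $\boldsymbol\mu_0=\big(\tfrac{(n-1)p}{2}+1,\tfrac{(n-1)p}{2}\big)'$,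 $\boldsymbol\mu_1=\big(\tfrac{(n-1)p}{2},\tfrac{(n-1)p}{2}+1\big)'$ and $\boldsymbol\Sigma=(n-1)\begin{pmatrix}\frac p2(1-\frac p2)&-\frac{p^2}{4}\\-\frac{p^2}{4}&\frac p2(1-\frac p2)\end{pmatrix}$, which are the means of $(n_0+1,n_1)$ and $(n_0,n_1+1)$ and their common covariance matrix for $(n_0,n_1,n_2)$ multinomial with parameters $(n-1;\frac p2,\frac p2,1-p)$. Then the Mahalanobis distance $\sqrt{(\boldsymbol\mu_1-\boldsymbol\mu_0)'\boldsymbol\Sigma^{-1}(\boldsymbol\mu_1-\boldsymbol\mu_0)}$ equals $\dfrac{2}{\sqrt{(n-1)p}}=\mu_n$, and $T\big(N(\boldsymbol\mu_0,\boldsymbol\Sigma),N(\boldsymbol\mu_1,\boldsymbol\Sigma)\big)=G_{\mu_n}$ on $[0,1]$. -/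

import Mathlib

universe u v w

open MeasureTheory ProbabilityTheory

noncomputable section

namespace ShuffleDP

/-! ### Trade-off functions and Gaussian differential privacy -/

/-- The trade-off function `T(U, V)`: the least type II error `1 - E_V[φ]` over all measurable
randomized rejection rules `0 ≤ φ ≤ 1` whose type I error `E_U[φ]` is at most `α`. -/
def tradeoff {Ω : Type w} [MeasurableSpace Ω] (U V : Measure Ω) (α : ℝ) : ℝ :=
  sInf {β : ℝ | ∃ φ : Ω → ℝ, Measurable φ ∧ (∀ ω, φ ω ∈ Set.Icc (0 : ℝ) 1) ∧
    ∫ ω, φ ω ∂U ≤ α ∧ β = 1 - ∫ ω, φ ω ∂V}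

/-- The Gaussian trade-off function `G_μ = T(N(0,1), N(μ,1))`. -/
def gaussianTradeoff (μ α : ℝ) : ℝ :=
  tradeoff (gaussianReal 0 1) (gaussianReal μ 1) α

/-- Two datasets of the same size are neighbouring if they differ in exactly one record. -/
def Neighbouring {D : Type u} {n : ℕ} (X₀ X₁ : Fin n → D) : Prop :=
  ∃ i, X₀ i ≠ X₁ i ∧ ∀ j, j ≠ i → X₀ j = X₁ j

/-- A mechanism `M` (dataset to law of the output) is `μ`-GDP up to the additive error `δ`:
its trade-off functions on neighbouring datasets are at least `G_μ - δ` on `[0, 1]`.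
For `δ = 0` this is `μ`-GDP. -/
def IsGDPUpTo {D : Type u} {n : ℕ} {Ω : Type w} [MeasurableSpace Ω]
    (M : (Fin n → D) → Measure Ω) (μ δ : ℝ) : Prop :=
  ∀ X₀ X₁ : Fin n → D, Neighbouring X₀ X₁ → ∀ α ∈ Set.Icc (0 : ℝ) 1,
    gaussianTradeoff μ α - δ ≤ tradeoff (M X₀) (M X₁) α

/-! ### Adaptive processes -/

/-- A randomizer on single records is `ε`-LDP. -/
def IsLDP {D : Type u} {Ω : Type w} [MeasurableSpace Ω] (ε : ℝ) (M : D → Measure Ω) : Prop :=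
  ∀ x x' : D, ∀ E : Set Ω, MeasurableSet E → M x E ≤ ENNReal.ofReal (Real.exp ε) * M x' E

section Adaptive

variable {D : Type u} {S : ℕ → Type v} [∀ i, MeasurableSpace (S i)]

/-- Appending the next output `z_k` to the outputs `z_0, …, z_{k-1}`. -/
def append (k : ℕ) (q : ((j : Fin k) → S j) × S k) : (j : Fin (k + 1)) → S j :=
  Fin.snoc (α := fun j : Fin (k + 1) => S j) q.1 q.2

theorem measurable_append (k : ℕ) : Measurable (append (S := S) k) := by
  refine measurable_pi_iff.mpr fun j => ?_
  refine Fin.lastCases ?_ (fun i => ?_) j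
  · have h : (fun q : ((j : Fin k) → S j) × S k => append k q (Fin.last k)) = fun q => q.2 := by
      funext q
      exact Fin.snoc_last (α := fun j : Fin (k + 1) => S j) q.2 q.1
    rw [h]
    exact measurable_snd
  · have h : (fun q : ((j : Fin k) → S j) × S k => append k q i.castSucc) = fun q => q.1 i := by
      funext q
      exact Fin.snoc_castSucc (α := fun j : Fin (k + 1) => S j) q.2 q.1 i
    rw [h]
    exact (measurable_pi_apply i).comp measurable_fst

/-- The law of the outputs `z_{1:k}` of the adaptive process on the dataset `x_{1:k}`:
successively `z_i` is drawn from `R i x_i z_{1:i-1}`. Indices start at `0`. -/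
def adaptiveLaw (R : (i : ℕ) → D → Kernel ((j : Fin i) → S j) (S i)) :
    (k : ℕ) → (Fin k → D) → Measure ((j : Fin k) → S j)
  | 0, _ => Measure.dirac (fun j => j.elim0)
  | k + 1, x =>
    ((adaptiveLaw R k (Fin.init x)) ⊗ₘ (R k (x (Fin.last k)))).map (append k)

/-- The law of the shuffled adaptive process: a permutation `π` of the `n` records is drawn
uniformly, and then the adaptive process is run on `x_{π 1}, …, x_{π n}`. -/
def shuffledLaw (R : (i : ℕ) → D → Kernel ((j : Fin i) → S j) (S i)) (n : ℕ)
    (X : Fin n → D) : Measure ((j : Fin n) → S j) :=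
  ((Nat.factorial n : ENNReal)⁻¹) • ∑ π : Equiv.Perm (Fin n), adaptiveLaw R n (fun i => X (π i))

/-- The first `n` steps of the process are `ε`-LDP, for all values of the previous outputs. -/
def IsLDPProcess (ε : ℝ) (n : ℕ)
    (R : (i : ℕ) → D → Kernel ((j : Fin i) → S j) (S i)) : Prop :=
  ∀ i < n, ∀ z : (j : Fin i) → S j, IsLDP ε (fun x => R i x z)

end Adaptive

/-! ### The parameter and the bivariate Gaussians -/

/-- `μ_n = 2 e^{ε/2} / √(n - 1)`. -/
def gdpParam (ε : ℝ) (n : ℕ) : ℝ := 2 * Real.exp (ε / 2) / Real.sqrt ((n : ℝ) - 1)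

/-- The mean of `(n₀ + 1, n₁)` for `(n₀, n₁, n₂)` multinomial with parameters
`(n - 1; p/2, p/2, 1 - p)`. -/
def mean₀ (p : ℝ) (n : ℕ) : EuclideanSpace ℝ (Fin 2) :=
  !₂[((n : ℝ) - 1) * p / 2 + 1, ((n : ℝ) - 1) * p / 2]

/-- The mean of `(n₀, n₁ + 1)`. -/
def mean₁ (p : ℝ) (n : ℕ) : EuclideanSpace ℝ (Fin 2) :=
  !₂[((n : ℝ) - 1) * p / 2, ((n : ℝ) - 1) * p / 2 + 1]

/-- The covariance matrix of `(n₀, n₁)`. -/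
def covMat (p : ℝ) (n : ℕ) : Matrix (Fin 2) (Fin 2) ℝ :=
  ((n : ℝ) - 1) • !![p / 2 * (1 - p / 2), -(p ^ 2 / 4); -(p ^ 2 / 4), p / 2 * (1 - p / 2)]

/-- The Mahalanobis distance `√((y - x)ᵀ Σ⁻¹ (y - x))`. -/
def mahalanobis (Sig : Matrix (Fin 2) (Fin 2) ℝ) (x y : EuclideanSpace ℝ (Fin 2)) : ℝ :=
  Real.sqrt ((y - x).ofLp ⬝ᵥ (Sig⁻¹.mulVec (y - x).ofLp))

end ShuffleDP

end

noncomputable section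

namespace ShuffleDP

/-! ### Elementary properties of trade-off functions -/

section Tradeoff

variable {Ω : Type w} [MeasurableSpace Ω] {U V : Measure Ω}

/-! Put p = exp(-ε₀), and let i be the record in which the datasets differ. The LDP inequality
bounds every randomizer below by p times the randomizer at X₀ i and at X₁ i, so each other record
acts, with probability p, as a clone of X₀ i or X₁ i with equal chances, and otherwise follows a
residual kernel (`exists_residual_kernel`). Encode this by labels -1, 1, 0. Given all labels, the
output law is the same under both hypotheses. Only the label of i tells them apart: it is -1 under
X₀ and 1 under X₁. A test on outputs thus becomes a function g of the labels, and shuffling makes g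
invariant under exchanging i with another cloned record (`exists_label_test`).

Against the law P with a fair sign at i, the hypotheses have densities 1 - l i and 1 + l i, so power
minus level is 2 E[l i · g]. By exchangeability l i may be replaced by the mean label of the clones
(`integral_label_mul`). With W the normalized sum of the other labels, twice this mean is μ_n W up
to an error of order μ_n² in expectation. Weak duality gives E[g W] ≤ t E[g] + E(W - t)⁺ for every
t, and the central limit theorem replaces W by a standard Gaussian Z.

On the Gaussian side, the test x > t of level α has power at least α + μ (α t + E(Z - t)⁺) - μ²/2
(`le_gaussianReal_Ioi`), which matches to first order. Finitely many thresholds t serve all α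
(`exists_finite_thresholds`), so the o(μ_n) error is uniform in α; it is uniform in the process
because the label problem depends only on p, n and i.

For the bivariate Gaussians, the mean difference (-1, 1) is an eigenvector of the covariance matrix.
The orthogonal coordinate is independent noise with the same law under both hypotheses, and the
problem reduces to one dimension. -/

theorem integrable_test [IsFiniteMeasure U] {φ : Ω → ℝ} (hφ : Measurable φ)
    (h01 : ∀ ω, φ ω ∈ Set.Icc (0 : ℝ) 1) : Integrable φ U :=
  Integrable.of_mem_Icc 0 1 hφ.aemeasurable (Filter.Eventually.of_forall h01)

theorem integral_test_mem_Icc [IsProbabilityMeasure U] {φ : Ω → ℝ} (hφ : Measurable φ)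
    (h01 : ∀ ω, φ ω ∈ Set.Icc (0 : ℝ) 1) : ∫ ω, φ ω ∂U ∈ Set.Icc (0 : ℝ) 1 := by
  refine ⟨integral_nonneg fun ω => (h01 ω).1, ?_⟩
  calc ∫ ω, φ ω ∂U ≤ ∫ _, (1 : ℝ) ∂U :=
        integral_mono (integrable_test hφ h01) (integrable_const _) fun ω => (h01 ω).2
    _ = 1 := by simp

theorem tradeoff_le [IsProbabilityMeasure V] {φ : Ω → ℝ} {α : ℝ} (hφ : Measurable φ)
    (h01 : ∀ ω, φ ω ∈ Set.Icc (0 : ℝ) 1) (hα : ∫ ω, φ ω ∂U ≤ α) :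
    tradeoff U V α ≤ 1 - ∫ ω, φ ω ∂V := by
  refine csInf_le ⟨0, ?_⟩ ⟨φ, hφ, h01, hα, rfl⟩
  rintro _ ⟨ψ, hψ, hψ01, -, rfl⟩
  linarith [(integral_test_mem_Icc (U := V) hψ hψ01).2]

/-- For 0 ≤ α the test φ = 0 is admissible, so the infimum is over a nonempty set and is not the
default value 0 of `sInf`. -/
theorem le_tradeoff {c α : ℝ} (hα : 0 ≤ α)
    (h : ∀ φ : Ω → ℝ, Measurable φ → (∀ ω, φ ω ∈ Set.Icc (0 : ℝ) 1) →
      ∫ ω, φ ω ∂U ≤ α → c ≤ 1 - ∫ ω, φ ω ∂V) : c ≤ tradeoff U V α := by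
  refine le_csInf ⟨_, fun _ => 0, measurable_const, by simp, by simpa using hα, rfl⟩ ?_
  rintro _ ⟨φ, hφ, h01, hle, rfl⟩
  exact h φ hφ h01 hle

theorem tradeoff_antitone [IsProbabilityMeasure V] {α α' : ℝ} (hα : 0 ≤ α) (h : α ≤ α') :
    tradeoff U V α' ≤ tradeoff U V α :=
  le_tradeoff hα fun _ hφ h01 hle => tradeoff_le hφ h01 (hle.trans h)

/-- Data processing for deterministic maps. -/
theorem tradeoff_le_tradeoff_map {Ω' : Type*} [MeasurableSpace Ω'] [IsProbabilityMeasure V]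
    {f : Ω → Ω'} (hf : Measurable f) {α : ℝ} (hα : 0 ≤ α) :
    tradeoff U V α ≤ tradeoff (U.map f) (V.map f) α := by
  refine le_tradeoff hα fun φ hφ h01 hle => ?_
  rw [integral_map hf.aemeasurable hφ.aestronglyMeasurable] at hle ⊢
  exact tradeoff_le (hφ.comp hf) (fun ω => h01 _) hle

/-- Independent noise with the same law under both hypotheses does not help. -/
theorem tradeoff_le_tradeoff_prod {Ω' : Type*} [MeasurableSpace Ω'] [IsProbabilityMeasure U]
    [IsProbabilityMeasure V] (N : Measure Ω') [IsProbabilityMeasure N] {α : ℝ} (hα : 0 ≤ α) :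
    tradeoff U V α ≤ tradeoff (U.prod N) (V.prod N) α := by
  refine le_tradeoff hα fun φ hφ h01 hle => ?_
  rw [integral_prod _ (integrable_test hφ h01)] at hle ⊢
  -- Averaging the test over the noise leaves both error probabilities unchanged.
  refine tradeoff_le (φ := fun x => ∫ y, φ (x, y) ∂N) ?_ (fun x => ?_) hle
  · exact (hφ.stronglyMeasurable.integral_prod_right').measurable
  · exact integral_test_mem_Icc (by fun_prop) fun y => h01 _

end Tradeoff

/-! ### Adaptive processes driven by mixtures of randomizers -/

section Mixture

variable {D : Type u} {S : ℕ → Type v} [∀ i, MeasurableSpace (S i)]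

instance isProbabilityMeasure_adaptiveLaw (R : (i : ℕ) → D → Kernel ((j : Fin i) → S j) (S i))
    [∀ i x, IsMarkovKernel (R i x)] (k : ℕ) (x : Fin k → D) :
    IsProbabilityMeasure (adaptiveLaw R k x) := by
  induction k with
  | zero => rw [adaptiveLaw]; infer_instance
  | succ k ih =>
    rw [adaptiveLaw]
    exact Measure.isProbabilityMeasure_map (measurable_append k).aemeasurable

theorem isProbabilityMeasure_inv_smul_sum {ι Ω : Type*} [Fintype ι] [MeasurableSpace Ω]
    {N : ℕ} (hN : Fintype.card ι = N) (hN0 : N ≠ 0) (μ : ι → Measure Ω)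
    [∀ i, IsProbabilityMeasure (μ i)] : IsProbabilityMeasure ((N : ENNReal)⁻¹ • ∑ i, μ i) := by
  constructor
  simp only [Measure.smul_apply, Measure.finsetSum_apply, measure_univ, Finset.sum_const,
    Finset.card_univ, hN, nsmul_eq_mul, mul_one, smul_eq_mul]
  exact ENNReal.inv_mul_cancel (by exact_mod_cast hN0) (ENNReal.natCast_ne_top _)

instance isProbabilityMeasure_shuffledLaw (R : (i : ℕ) → D → Kernel ((j : Fin i) → S j) (S i))
    [∀ i x, IsMarkovKernel (R i x)] (n : ℕ) (X : Fin n → D) :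
    IsProbabilityMeasure (shuffledLaw R n X) :=
  isProbabilityMeasure_inv_smul_sum (by simp [Fintype.card_perm]) (Nat.factorial_ne_zero n) _

/-- The law of an adaptive process is multilinear in the randomizers. -/
theorem adaptiveLaw_eq_sum {D' ι : Type*} [Fintype ι]
    (R : (i : ℕ) → D → Kernel ((j : Fin i) → S j) (S i)) [∀ i x, IsMarkovKernel (R i x)]
    (K : (i : ℕ) → D' → Kernel ((j : Fin i) → S j) (S i)) [∀ i x, IsMarkovKernel (K i x)]
    (k : ℕ) (x : Fin k → D) (y : Fin k → ι → D') (c : Fin k → ι → ENNReal)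
    (h : ∀ (i : Fin k) (z : (j : Fin (i : ℕ)) → S j),
      R i (x i) z = ∑ s, c i s • K i (y i s) z) :
    adaptiveLaw R k x =
      ∑ l : Fin k → ι, (∏ i, c i (l i)) • adaptiveLaw K k (fun i => y i (l i)) := by
  induction k with
  | zero => simp [adaptiveLaw]
  | succ k ih =>
    have ih' := ih (Fin.init x) (fun i => y i.castSucc) (fun i => c i.castSucc)
      (fun i z => h i.castSucc z)
    have hlast := h (Fin.last k)
    ext E hE
    have hE' : MeasurableSet (append k ⁻¹' E) := measurable_append k hE
    -- Split off the last component index, so that the product of weights factors along the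
    -- recursion.
    rw [← (Fin.snocEquiv fun _ => ι).sum_comp, Fintype.sum_prod_type]
    simp only [adaptiveLaw, Measure.map_apply (measurable_append k) hE,
      Measure.compProd_apply hE', Measure.finsetSum_apply, Measure.smul_apply, smul_eq_mul]
    rw [ih', lintegral_finsetSum_measure, Finset.sum_comm]
    refine Finset.sum_congr rfl fun l _ => ?_
    have hm : ∀ s, Measurable fun a : (j : Fin k) → S j =>
        K k (y (Fin.last k) s) a (Prod.mk a ⁻¹' (append k ⁻¹' E)) := fun s =>
      Kernel.measurable_kernel_prodMk_left hE'
    have hl : ∀ a : (j : Fin k) → S j, R k (x (Fin.last k)) a (Prod.mk a ⁻¹' (append k ⁻¹' E))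
        = ∑ s, c (Fin.last k) s *
          K k (y (Fin.last k) s) a (Prod.mk a ⁻¹' (append k ⁻¹' E)) := fun a => by
      have := congrArg (fun ν => ν (Prod.mk a ⁻¹' (append k ⁻¹' E))) (hlast a)
      simpa [Measure.finsetSum_apply] using this
    simp only [lintegral_smul_measure, hl, smul_eq_mul]
    rw [lintegral_finsetSum _ fun s _ => (hm s).const_mul _, Finset.mul_sum]
    refine Finset.sum_congr rfl fun s _ => ?_
    rw [lintegral_const_mul _ (hm s), Fin.prod_univ_castSucc, ← mul_assoc]
    have e1 : ∀ i : Fin k, (Fin.snocEquiv fun _ => ι) (s, l) i.castSucc = l i := fun i => by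
      simp [Fin.snocEquiv]
    have e2 : (Fin.snocEquiv fun _ => ι) (s, l) (Fin.last k) = s := by simp [Fin.snocEquiv]
    have e3 : (Fin.init fun i => y i ((Fin.snocEquiv fun _ => ι) (s, l) i))
        = fun i : Fin k => y i.castSucc (l i) := by
      funext i; simp only [Fin.init, e1]
    simp only [e1, e2, e3]

/-- Multilinearity with a single component of weight 1: the law sees the records only through their
kernels. This serves to exchange records that use the same clone kernel. -/
theorem adaptiveLaw_congr (K : (i : ℕ) → D → Kernel ((j : Fin i) → S j) (S i))
    [∀ i x, IsMarkovKernel (K i x)] (k : ℕ) (x y : Fin k → D)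
    (h : ∀ i : Fin k, K i (x i) = K i (y i)) : adaptiveLaw K k x = adaptiveLaw K k y := by
  have := adaptiveLaw_eq_sum K K k x (fun i (_ : Unit) => y i) (fun _ _ => 1)
    (fun i z => by simp [h i])
  simpa using this

/-- If `p κ₀ ≤ κ` and `p κ₁ ≤ κ` then `κ` is a mixture of `κ₀`, `κ₁` and a third kernel. -/
theorem exists_residual_kernel {α β : Type*} [MeasurableSpace α] [MeasurableSpace β] {p : ℝ}
    (hp0 : 0 < p) (hp1 : p < 1) (κ κ₀ κ₁ : Kernel α β) [IsMarkovKernel κ] [IsMarkovKernel κ₀]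
    [IsMarkovKernel κ₁]
    (h₀ : ∀ a E, MeasurableSet E → ENNReal.ofReal p * κ₀ a E ≤ κ a E)
    (h₁ : ∀ a E, MeasurableSet E → ENNReal.ofReal p * κ₁ a E ≤ κ a E) :
    ∃ η : Kernel α β, IsMarkovKernel η ∧ ∀ a, κ a = ENNReal.ofReal (1 - p) • η a +
      (ENNReal.ofReal (p / 2) • κ₀ a + ENNReal.ofReal (p / 2) • κ₁ a) := by
  set c := ENNReal.ofReal (p / 2)
  have hc : c + c = ENNReal.ofReal p := by
    rw [← ENNReal.ofReal_add (by linarith) (by linarith)]; congr 1; ring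
  set d := ENNReal.ofReal (1 - p)
  have hd0 : d ≠ 0 := by simp only [d, ne_eq, ENNReal.ofReal_eq_zero]; linarith
  have hdt : d ≠ ⊤ := ENNReal.ofReal_ne_top
  have hcd : c + c + d = 1 := by
    rw [hc, ← ENNReal.ofReal_add hp0.le (by linarith)]; simp
  let ν : α → Measure β := fun a => c • κ₀ a + c • κ₁ a
  have hνfin : ∀ a, IsFiniteMeasure (ν a) := fun a => by
    constructor
    simp only [ν, Measure.add_apply, Measure.smul_apply, measure_univ, smul_eq_mul, mul_one, hc]
    exact ENNReal.ofReal_lt_top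
  have hνle : ∀ a, ν a ≤ κ a := fun a => by
    refine Measure.le_iff.2 fun E hE => ?_
    have h2 : (2 : ENNReal) ≠ 0 := by simp
    simp only [ν, Measure.add_apply, Measure.smul_apply, smul_eq_mul]
    rw [← ENNReal.mul_le_mul_iff_right h2 (by simp)]
    calc 2 * (c * κ₀ a E + c * κ₁ a E) = (c + c) * κ₀ a E + (c + c) * κ₁ a E := by ring
      _ ≤ κ a E + κ a E := by rw [hc]; exact add_le_add (h₀ a E hE) (h₁ a E hE)
      _ = 2 * κ a E := by ring
  -- Averaging the two lower bounds shows that κ dominates ν, which has mass p. The residual kernel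
  -- is the remainder divided by its mass 1 - p, positive because p < 1.
  have hm : Measurable fun a => d⁻¹ • (κ a - ν a) := by
    refine Measure.measurable_of_measurable_coe _ fun E hE => ?_
    have : (fun a => (d⁻¹ • (κ a - ν a)) E) =
        fun a => d⁻¹ * (κ a E - (c * κ₀ a E + c * κ₁ a E)) := by
      funext a
      rw [Measure.smul_apply, Measure.sub_apply hE (hνle a)]
      rfl
    rw [this]
    exact ((κ.measurable_coe hE).sub (((κ₀.measurable_coe hE).const_mul _).add
      ((κ₁.measurable_coe hE).const_mul _))).const_mul _
  refine ⟨⟨_, hm⟩, ⟨fun a => ⟨?_⟩⟩, fun a => ?_⟩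
  · change (d⁻¹ • (κ a - ν a)) Set.univ = 1
    rw [Measure.smul_apply, Measure.sub_apply MeasurableSet.univ (hνle a)]
    simp only [ν, Measure.add_apply, Measure.smul_apply, measure_univ, smul_eq_mul, mul_one]
    rw [← hcd, ENNReal.add_sub_cancel_left (by rw [hc]; exact ENNReal.ofReal_ne_top)]
    exact (ENNReal.inv_mul_cancel hd0 hdt).trans hcd.symm
  · change κ a = d • (d⁻¹ • (κ a - ν a)) + ν a
    rw [smul_smul, ENNReal.mul_inv_cancel hd0 hdt, one_smul,
      Measure.sub_add_cancel_of_le (hνle a)]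

end Mixture

/-! ### Random labels

A record labelled `-1` or `1` is replaced by a clone of one of the two differing records; a record
labelled `0` keeps its own value. -/

/-- With the discrete σ-algebra, measurability and integrability of functions of finitely many
labels are automatic. -/
instance : MeasurableSpace SignType := ⊤

instance : DiscreteMeasurableSpace SignType := ⟨fun _ => trivial⟩

/-- The probability of a label, if the record is cloned with probability `q`. -/
def labelWeight (q : ℝ) (s : SignType) : ℝ := if s = 0 then 1 - q else q / 2

theorem labelWeight_nonneg {q : ℝ} (h0 : 0 ≤ q) (h1 : q ≤ 1) (s : SignType) :
    0 ≤ labelWeight q s := by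
  unfold labelWeight; split_ifs <;> linarith

theorem sum_signType {M : Type*} [AddCommMonoid M] (f : SignType → M) :
    ∑ s, f s = f 0 + (f (-1) + f 1) := by
  have : (Finset.univ : Finset SignType) = {0, -1, 1} := rfl
  rw [this, Finset.sum_insert (by decide), Finset.sum_insert (by decide), Finset.sum_singleton]

/-- The law of a label. -/
def labelMeasure (q : ℝ) : Measure SignType :=
  ∑ s, ENNReal.ofReal (labelWeight q s) • Measure.dirac s

theorem labelMeasure_singleton (q : ℝ) (s : SignType) :
    labelMeasure q {s} = ENNReal.ofReal (labelWeight q s) := by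
  rw [labelMeasure, Measure.finsetSum_apply, Finset.sum_eq_single s]
  · simp
  · intro t _ ht; simp [ht]
  · simp

theorem isProbabilityMeasure_labelMeasure {q : ℝ} (h0 : 0 ≤ q) (h1 : q ≤ 1) :
    IsProbabilityMeasure (labelMeasure q) := by
  constructor
  simp only [labelMeasure, Measure.finsetSum_apply, Measure.smul_apply, measure_univ, smul_eq_mul,
    mul_one]
  rw [← ENNReal.ofReal_sum_of_nonneg fun s _ => labelWeight_nonneg h0 h1 s, sum_signType]
  simp [labelWeight]

theorem integral_labelMeasure {q : ℝ} (h0 : 0 ≤ q) (h1 : q ≤ 1) (f : SignType → ℝ) :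
    ∫ s, f s ∂labelMeasure q = (1 - q) * f 0 + (q / 2 * f (-1) + q / 2 * f 1) := by
  have := isProbabilityMeasure_labelMeasure h0 h1
  rw [integral_fintype .of_finite, sum_signType]
  simp only [Measure.real, labelMeasure_singleton,
    ENNReal.toReal_ofReal (labelWeight_nonneg h0 h1 _)]
  simp [labelWeight]

/-- The cloning probability of the record `j`, if `i` is the record that is always cloned. -/
def cloneProb {n : ℕ} (p : ℝ) (i j : Fin n) : ℝ := if j = i then 1 else p

/-- The law of independent labels: record `i` is always cloned, any other record with
probability `p`. -/
def labelLaw {n : ℕ} (p : ℝ) (i : Fin n) : Measure (Fin n → SignType) :=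
  Measure.pi fun j => labelMeasure (cloneProb p i j)

section LabelLaw

variable {n : ℕ} {p : ℝ}

theorem cloneProb_mem (hp0 : 0 ≤ p) (hp1 : p ≤ 1) (i j : Fin n) :
    0 ≤ cloneProb p i j ∧ cloneProb p i j ≤ 1 := by
  unfold cloneProb; split_ifs <;> constructor <;> linarith

theorem isProbabilityMeasure_labelMeasure_cloneProb (hp0 : 0 ≤ p) (hp1 : p ≤ 1)
    (i j : Fin n) :
    IsProbabilityMeasure (labelMeasure (cloneProb p i j)) :=
  isProbabilityMeasure_labelMeasure (cloneProb_mem hp0 hp1 i j).1 (cloneProb_mem hp0 hp1 i j).2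

theorem isProbabilityMeasure_labelLaw (hp0 : 0 ≤ p) (hp1 : p ≤ 1) (i : Fin n) :
    IsProbabilityMeasure (labelLaw p i) := by
  have := isProbabilityMeasure_labelMeasure_cloneProb hp0 hp1 i
  unfold labelLaw; infer_instance

theorem integral_labelLaw (hp0 : 0 ≤ p) (hp1 : p ≤ 1) (i : Fin n)
    (f : (Fin n → SignType) → ℝ) :
    ∫ l, f l ∂labelLaw p i = ∑ l, (∏ j, labelWeight (cloneProb p i j) (l j)) * f l := by
  have := isProbabilityMeasure_labelLaw hp0 hp1 i
  have := isProbabilityMeasure_labelMeasure_cloneProb hp0 hp1 i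
  rw [integral_fintype .of_finite]
  refine Finset.sum_congr rfl fun l _ => ?_
  rw [Measure.real, labelLaw, Measure.pi_singleton, ENNReal.toReal_prod, smul_eq_mul]
  simp only [labelMeasure_singleton, ENNReal.toReal_ofReal
    (labelWeight_nonneg (cloneProb_mem hp0 hp1 i _).1 (cloneProb_mem hp0 hp1 i _).2 _)]

end LabelLaw

/-- The probability of a label of record `j`, conditionally on record `i` having label `b`. -/
def condWeight {n : ℕ} (p : ℝ) (i : Fin n) (b : SignType) (j : Fin n) (s : SignType) : ℝ :=
  if j = i then (if s = b then 1 else 0) else labelWeight p s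

theorem condWeight_nonneg {n : ℕ} {p : ℝ} (hp0 : 0 ≤ p) (hp1 : p ≤ 1) (i : Fin n) (b : SignType)
    (j : Fin n) (s : SignType) : 0 ≤ condWeight p i b j s := by
  unfold condWeight
  split_ifs
  · exact zero_le_one
  · exact le_rfl
  · exact labelWeight_nonneg hp0 hp1 s

/-- Conditioning a fair sign on the value b multiplies its law by 2 at b and by 0 at -b, that is, by
1 + b · l i. If l i = 0 both sides vanish. -/
theorem prod_condWeight {n : ℕ} (p : ℝ) (i : Fin n) {b : SignType} (hb : b ≠ 0)
    (l : Fin n → SignType) :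
    ∏ j, condWeight p i b j (l j) =
      (∏ j, labelWeight (cloneProb p i j) (l j)) * (1 + (b : ℝ) * (l i : ℝ)) := by
  rw [← Finset.mul_prod_erase _ _ (Finset.mem_univ i),
    ← Finset.mul_prod_erase (f := fun j => labelWeight _ _) _ (Finset.mem_univ i)]
  have h : ∀ j ∈ Finset.univ.erase i, condWeight p i b j (l j) =
      labelWeight (cloneProb p i j) (l j) := fun j hj => by
    simp [condWeight, cloneProb, Finset.ne_of_mem_erase hj]
  rw [Finset.prod_congr rfl h, mul_right_comm]
  congr 1
  simp only [condWeight, cloneProb, labelWeight, if_true]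
  generalize l i = s
  clear h
  cases b <;> cases s <;> simp_all <;> norm_num

/-- The reduction of the shuffled process to random labels: a test for the outputs of the shuffled
process acts as a test for the labels. The latter is invariant under exchanging the labels of the
record `i` and another cloned record. -/
theorem exists_label_test {D : Type u} {S : ℕ → Type v} [∀ i, MeasurableSpace (S i)] {p : ℝ}
    (hp0 : 0 < p) (hp1 : p < 1) {n : ℕ}
    (R : (i : ℕ) → D → Kernel ((j : Fin i) → S j) (S i)) [∀ i x, IsMarkovKernel (R i x)]
    (hR : ∀ k < n, ∀ z x x' E, MeasurableSet E → ENNReal.ofReal p * R k x z E ≤ R k x' z E)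
    (X₀ X₁ : Fin n → D) (i : Fin n) (hX : ∀ j, j ≠ i → X₀ j = X₁ j)
    (φ : ((j : Fin n) → S j) → ℝ) (hφ : Measurable φ) (h01 : ∀ z, φ z ∈ Set.Icc (0 : ℝ) 1) :
    ∃ g : (Fin n → SignType) → ℝ, (∀ l, g l ∈ Set.Icc (0 : ℝ) 1) ∧
      (∀ l j, l i ≠ 0 → l j ≠ 0 → g (l ∘ Equiv.swap i j) = g l) ∧
      ∫ z, φ z ∂shuffledLaw R n X₀ = ∫ l, (1 - (l i : ℝ)) * g l ∂labelLaw p i ∧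
      ∫ z, φ z ∂shuffledLaw R n X₁ = ∫ l, (1 + (l i : ℝ)) * g l ∂labelLaw p i := by
  have hres : ∀ (k : ℕ) (x : D), ∃ η : Kernel ((j : Fin k) → S j) (S k), IsMarkovKernel η ∧
      (k < n → ∀ z, R k x z = ENNReal.ofReal (1 - p) • η z +
        (ENNReal.ofReal (p / 2) • R k (X₀ i) z + ENNReal.ofReal (p / 2) • R k (X₁ i) z)) := by
    intro k x
    by_cases hk : k < n
    · obtain ⟨η, h1, h2⟩ := exists_residual_kernel hp0 hp1 (R k x) (R k (X₀ i)) (R k (X₁ i))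
        (fun a E hE => hR k hk a _ _ E hE) (fun a E hE => hR k hk a _ _ E hE)
      exact ⟨η, h1, fun _ => h2⟩
    -- Steps from n on satisfy no LDP bound and never occur; any Markov kernel will do.
    · exact ⟨R k x, inferInstance, fun h => absurd h hk⟩
  choose η hη1 hη2 using hres
  -- With a nonzero label the kernel no longer depends on the record; this is the source of the
  -- symmetry of `F`.
  let K : (k : ℕ) → SignType × D → Kernel ((j : Fin k) → S j) (S k) := fun k q =>
    if q.1 = 0 then η k q.2 else if q.1 = 1 then R k (X₁ i) else R k (X₀ i)
  have hK : ∀ k q, IsMarkovKernel (K k q) := fun k q => by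
    have := hη1 k q.2
    simp only [K]; split_ifs <;> infer_instance
  let F : (Fin n → SignType) → Measure ((j : Fin n) → S j) := fun l =>
    ((Nat.factorial n : ENNReal)⁻¹) •
      ∑ π : Equiv.Perm (Fin n), adaptiveLaw K n (fun k => (l (π k), X₀ (π k)))
  have hF : ∀ l, IsProbabilityMeasure (F l) := fun l =>
    isProbabilityMeasure_inv_smul_sum (by simp [Fintype.card_perm]) (Nat.factorial_ne_zero n) _
  have hFsymm : ∀ l j, l i ≠ 0 → l j ≠ 0 → F (l ∘ Equiv.swap i j) = F l := by
    intro l j hi hj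
    simp only [F]
    congr 1
    -- After this reindexing the labels agree and only the records i and j are exchanged. Both carry
    -- nonzero labels, where `K` ignores the record.
    rw [← Equiv.sum_comp (Equiv.mulLeft (Equiv.swap i j))]
    refine Finset.sum_congr rfl fun π _ => adaptiveLaw_congr K n _ _ fun k => ?_
    simp only [Function.comp, Equiv.coe_mulLeft, Equiv.Perm.mul_apply, Equiv.swap_apply_self]
    by_cases h : l (π k) = 0
    · have h1 : π k ≠ i := fun e => hi (e ▸ h)
      have h2 : π k ≠ j := fun e => hj (e ▸ h)
      rw [Equiv.swap_apply_of_ne_of_ne h1 h2]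
    · simp [K, h]
  have hmix : ∀ (b : SignType) (X : Fin n → D), b ≠ 0 → (∀ j, j ≠ i → X j = X₀ j) →
      (∀ k, K k (b, X₀ i) = R k (X i)) → shuffledLaw R n X =
        ∑ l, ENNReal.ofReal (∏ j, condWeight p i b j (l j)) • F l := by
    intro b X hb hXj hXi
    have hπ : ∀ π : Equiv.Perm (Fin n), adaptiveLaw R n (fun k => X (π k)) =
        ∑ l : Fin n → SignType, ENNReal.ofReal (∏ j, condWeight p i b j (l j)) •
          adaptiveLaw K n (fun k => (l (π k), X₀ (π k))) := by
      intro π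
      -- Multilinearity produces labels indexed by time; composition with π indexes them by record,
      -- so that the weights no longer depend on π.
      rw [adaptiveLaw_eq_sum R K n _ (fun k s => (s, X₀ (π k)))
        (fun k s => ENNReal.ofReal (condWeight p i b (π k) s)) ?_,
        ← (Equiv.arrowCongr π.symm (Equiv.refl SignType)).sum_comp]
      · refine Finset.sum_congr rfl fun l _ => ?_
        rw [ENNReal.ofReal_prod_of_nonneg fun j _ => condWeight_nonneg hp0.le hp1.le i b j _,
          ← Equiv.prod_comp π fun j => ENNReal.ofReal (condWeight p i b j (l j))]
        rfl
      · intro k z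
        rw [sum_signType]
        by_cases hk : π k = i
        · rw [hk, ← hXi]
          obtain rfl | rfl : b = -1 ∨ b = 1 := by
            have : ∀ s : SignType, s ≠ 0 → s = -1 ∨ s = 1 := by decide
            exact this b hb
          · simp [condWeight]
          · simp [condWeight]
        · rw [hXj _ hk, hη2 k _ k.2 z]
          simp [condWeight, hk, labelWeight, K]
    simp only [shuffledLaw, hπ, F, smul_comm _ ((Nat.factorial n : ENNReal)⁻¹)]
    rw [Finset.sum_comm, ← Finset.smul_sum]
    simp only [Finset.smul_sum]
  have hint : ∀ (b : SignType) (X : Fin n → D), b ≠ 0 → (∀ j, j ≠ i → X j = X₀ j) →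
      (∀ k, K k (b, X₀ i) = R k (X i)) → ∫ z, φ z ∂shuffledLaw R n X =
        ∫ l, (1 + (b : ℝ) * (l i : ℝ)) * ∫ z, φ z ∂F l ∂labelLaw p i := by
    intro b X hb hXj hXi
    rw [hmix b X hb hXj hXi, integral_labelLaw hp0.le hp1.le, integral_finsetSum_measure
      fun l _ => (integrable_test hφ h01).smul_measure ENNReal.ofReal_ne_top]
    refine Finset.sum_congr rfl fun l _ => ?_
    rw [integral_smul_measure, ENNReal.toReal_ofReal
      (Finset.prod_nonneg fun j _ => condWeight_nonneg hp0.le hp1.le i b j _),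
      prod_condWeight p i hb, smul_eq_mul, mul_assoc]
  refine ⟨fun l => ∫ z, φ z ∂F l, fun l => integral_test_mem_Icc hφ h01,
    fun l j hi hj => by simp only [hFsymm l j hi hj], ?_, ?_⟩
  · have := hint (-1) X₀ (by decide) (fun _ _ => rfl) fun k => by simp [K]
    rw [this]
    refine integral_congr_ae (Filter.Eventually.of_forall fun l => ?_)
    simp only [SignType.coe_neg, SignType.coe_one]; ring
  · have := hint 1 X₁ (by decide) (fun j hj => (hX j hj).symm) fun k => by simp [K]
    rw [this]
    refine integral_congr_ae (Filter.Eventually.of_forall fun l => ?_)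
    simp only [SignType.coe_one]; ring

/-! ### Moments of the labels -/

/-- The sum of the labels of all records but `i`. -/
def othersSum {n : ℕ} (i : Fin n) (l : Fin n → SignType) : ℝ :=
  ∑ j ∈ Finset.univ.erase i, (l j : ℝ)

/-- The number of cloned records, apart from `i`. -/
def othersCount {n : ℕ} (i : Fin n) (l : Fin n → SignType) : ℝ :=
  ∑ j ∈ Finset.univ.erase i, (l j : ℝ) ^ 2

theorem abs_signType_le_sq (s : SignType) : |(s : ℝ)| ≤ (s : ℝ) ^ 2 := by
  cases s <;> simp

theorem sq_signType_le_one (s : SignType) : (s : ℝ) ^ 2 ≤ 1 := by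
  cases s <;> simp

theorem sq_signType_eq_one {s : SignType} (hs : s ≠ 0) : (s : ℝ) ^ 2 = 1 := by
  cases s <;> simp_all

section

variable {n : ℕ} {p : ℝ}

/-- When record i is cloned, the weight is 1/p times the weight under i.i.d. labels, which is
invariant under all permutations. -/
theorem prod_labelWeight_swap (hp0 : 0 < p) {i j : Fin n} {l : Fin n → SignType} (hi : l i ≠ 0)
    (hj : l j ≠ 0) :
    ∏ k, labelWeight (cloneProb p i k) ((l ∘ Equiv.swap i j) k) =
      ∏ k, labelWeight (cloneProb p i k) (l k) := by
  have key : ∀ l : Fin n → SignType, l i ≠ 0 →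
      ∏ k, labelWeight p (l k) = p * ∏ k, labelWeight (cloneProb p i k) (l k) := by
    intro l hi
    rw [← Finset.mul_prod_erase _ _ (Finset.mem_univ i),
      ← Finset.mul_prod_erase (f := fun k => labelWeight (cloneProb p i k) _) _
        (Finset.mem_univ i), ← mul_assoc]
    congr 1
    · simp only [labelWeight, hi, cloneProb, if_true, if_false]; ring
    · refine Finset.prod_congr rfl fun k hk => ?_
      simp [cloneProb, Finset.ne_of_mem_erase hk]
  have h1 := key l hi
  have h2 := key (l ∘ Equiv.swap i j) (by simpa using hj)
  have h3 : ∏ k, labelWeight p ((l ∘ Equiv.swap i j) k) = ∏ k, labelWeight p (l k) :=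
    Equiv.prod_comp (Equiv.swap i j) fun k => labelWeight p (l k)
  rw [h3, h1] at h2
  exact (mul_left_cancel₀ hp0.ne' h2).symm

/-- By exchangeability, the label of record `i` may be replaced by the mean label of all cloned
records. -/
theorem integral_label_mul (hp0 : 0 < p) (hp1 : p ≤ 1) (i : Fin n)
    (g : (Fin n → SignType) → ℝ)
    (hg : ∀ l j, l i ≠ 0 → l j ≠ 0 → g (l ∘ Equiv.swap i j) = g l) :
    ∫ l, (l i : ℝ) * g l ∂labelLaw p i =
      ∫ l, g l * ((∑ j, (l j : ℝ)) / ∑ j, (l j : ℝ) ^ 2) ∂labelLaw p i := by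
  rw [integral_labelLaw hp0.le hp1, integral_labelLaw hp0.le hp1]
  set V : (Fin n → SignType) → ℝ := fun l => ∏ j, labelWeight (cloneProb p i j) (l j) with hV
  set m : (Fin n → SignType) → ℝ := fun l => ∑ j, (l j : ℝ) ^ 2 with hm
  set f : (Fin n → SignType) → ℝ := fun l => V l * g l / m l with hf
  have hV0 : ∀ l, l i = 0 → V l = 0 := fun l hl =>
    Finset.prod_eq_zero (Finset.mem_univ i) (by simp [hl, labelWeight, cloneProb])
  have hmi : ∀ l, l i ≠ 0 → m l ≠ 0 := fun l hl => by
    have h1 : (l i : ℝ) ^ 2 ≤ m l :=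
      Finset.single_le_sum (f := fun j => (l j : ℝ) ^ 2) (fun j _ => sq_nonneg _)
        (Finset.mem_univ i)
    rw [sq_signType_eq_one hl] at h1
    linarith
  have hms : ∀ l j, m (l ∘ Equiv.swap i j) = m l := fun l j =>
    Equiv.sum_comp (Equiv.swap i j) fun k => (l k : ℝ) ^ 2
  have hfs : ∀ l j, l i ≠ 0 → l j ≠ 0 → f (l ∘ Equiv.swap i j) = f l := fun l j hi hj => by
    simp only [hf, hms, hg l j hi hj, hV, prod_labelWeight_swap hp0 hi hj]
  -- Since m = ∑ (l j)², the left side is a sum over j of f · l i · (l j)². Exchanging i and j turns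
  -- this term into f · l j · (l i)² = f · l j, and these add up to the right side.
  have h1 : ∀ l, V l * ((l i : ℝ) * g l) = ∑ j, f l * (l i : ℝ) * (l j : ℝ) ^ 2 := fun l => by
    rw [← Finset.mul_sum]
    by_cases h : l i = 0
    · simp [h]
    · simp only [hf]
      field_simp [hmi l h]
      ring
  have h2 : ∀ l, V l * (g l * ((∑ j, (l j : ℝ)) / m l)) = ∑ j, f l * (l j : ℝ) := fun l => by
    rw [← Finset.mul_sum]
    simp only [hf]; ring
  refine (Finset.sum_congr rfl fun l _ => h1 l).trans
    (Eq.trans ?_ (Finset.sum_congr rfl fun l _ => h2 l).symm)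
  rw [Finset.sum_comm, Finset.sum_comm (f := fun l j => f l * (l j : ℝ))]
  refine Finset.sum_congr rfl fun j _ => ?_
  rw [← ((Equiv.swap i j).arrowCongr (Equiv.refl SignType)).sum_comp]
  refine Finset.sum_congr rfl fun l _ => ?_
  have e : ((Equiv.swap i j).arrowCongr (Equiv.refl SignType)) l = l ∘ Equiv.swap i j := by
    ext k; simp [Equiv.arrowCongr]
  rw [e]
  simp only [Function.comp, Equiv.swap_apply_left, Equiv.swap_apply_right]
  by_cases hi : l i = 0
  · simp [hi, hf, hV0 l hi]
  by_cases hj : l j = 0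
  · simp [hj]
  · rw [hfs l j hi hj, sq_signType_eq_one hi, mul_one]

theorem iIndepFun_labels (hp0 : 0 ≤ p) (hp1 : p ≤ 1) (i : Fin n) (f : SignType → ℝ) :
    iIndepFun (fun j (l : Fin n → SignType) => f (l j)) (labelLaw p i) := by
  have := isProbabilityMeasure_labelMeasure_cloneProb hp0 hp1 i
  exact iIndepFun_pi (X := fun _ => f) fun j => Measurable.of_discrete.aemeasurable

theorem map_eval_labelLaw (hp0 : 0 ≤ p) (hp1 : p ≤ 1) {i j : Fin n} (hj : j ≠ i) :
    (labelLaw p i).map (fun l => l j) = labelMeasure p := by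
  have := isProbabilityMeasure_labelMeasure_cloneProb hp0 hp1 i
  have h := (measurePreserving_eval (fun j => labelMeasure (cloneProb p i j)) j).map_eq
  rw [cloneProb, if_neg hj] at h
  exact h

theorem integral_eval_labelLaw (hp0 : 0 ≤ p) (hp1 : p ≤ 1) {i j : Fin n} (hj : j ≠ i)
    (f : SignType → ℝ) : ∫ l, f (l j) ∂labelLaw p i = ∫ s, f s ∂labelMeasure p := by
  rw [← map_eval_labelLaw hp0 hp1 hj, integral_map Measurable.of_discrete.aemeasurable
    Measurable.of_discrete.aestronglyMeasurable]

/-- The labels of the n - 1 other records are i.i.d., so variances add. Applied to f(s) = s for the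
sum of labels and to f(s) = s² for the number of clones. -/
theorem integral_sq_sum_others (hp0 : 0 ≤ p) (hp1 : p ≤ 1) (i : Fin n) (f : SignType → ℝ) :
    ∫ l, (∑ j ∈ Finset.univ.erase i, f (l j) - ((n : ℝ) - 1) * ∫ s, f s ∂labelMeasure p) ^ 2
      ∂labelLaw p i = ((n : ℝ) - 1) * ∫ s, (f s - ∫ s, f s ∂labelMeasure p) ^ 2 ∂labelMeasure p := by
  have := isProbabilityMeasure_labelLaw hp0 hp1 i
  have := isProbabilityMeasure_labelMeasure hp0 hp1
  have hn : ((Finset.univ.erase i).card : ℝ) = (n : ℝ) - 1 := by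
    rw [Finset.card_erase_of_mem (Finset.mem_univ i), Finset.card_univ, Fintype.card_fin,
      Nat.cast_sub (by have := i.2; omega)]
    simp
  have hvar := IndepFun.variance_sum (μ := labelLaw p i) (s := Finset.univ.erase i)
    (X := fun j (l : Fin n → SignType) => f (l j)) (fun j _ => .of_discrete)
    fun j _ k _ hjk => (iIndepFun_labels hp0 hp1 i f).indepFun hjk
  have hmean : ∫ l, (∑ j ∈ Finset.univ.erase i, fun l : Fin n → SignType => f (l j)) l
      ∂labelLaw p i = ((n : ℝ) - 1) * ∫ s, f s ∂labelMeasure p := by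
    simp only [Finset.sum_apply]
    rw [integral_finsetSum _ fun j _ => .of_finite, Finset.sum_congr rfl fun j hj =>
      integral_eval_labelLaw hp0 hp1 (Finset.ne_of_mem_erase hj) f, Finset.sum_const,
      nsmul_eq_mul, hn]
  rw [variance_eq_integral Measurable.of_discrete.aemeasurable, hmean] at hvar
  simp only [Finset.sum_apply] at hvar
  rw [hvar, ← hn, ← nsmul_eq_mul, ← Finset.sum_const]
  refine Finset.sum_congr rfl fun j hj => ?_
  have hj' := Finset.ne_of_mem_erase hj
  rw [variance_eq_integral Measurable.of_discrete.aemeasurable,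
    integral_eval_labelLaw hp0 hp1 hj' f,
    integral_eval_labelLaw hp0 hp1 hj' fun s => (f s - ∫ s, f s ∂labelMeasure p) ^ 2]

theorem integral_othersSum_sq (hp0 : 0 ≤ p) (hp1 : p ≤ 1) (i : Fin n) :
    ∫ l, othersSum i l ^ 2 ∂labelLaw p i = ((n : ℝ) - 1) * p := by
  have h := integral_sq_sum_others hp0 hp1 i fun s => (s : ℝ)
  simp only [integral_labelMeasure hp0 hp1] at h
  simp only [othersSum]
  simp only [SignType.coe_zero, SignType.coe_neg, SignType.coe_one] at h
  ring_nf at h ⊢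
  exact h

theorem integral_othersCount_sub_sq (hp0 : 0 ≤ p) (hp1 : p ≤ 1) (i : Fin n) :
    ∫ l, (othersCount i l - ((n : ℝ) - 1) * p) ^ 2 ∂labelLaw p i
      = ((n : ℝ) - 1) * (p * (1 - p)) := by
  have h := integral_sq_sum_others hp0 hp1 i fun s => (s : ℝ) ^ 2
  have hc : ∫ s : SignType, (s : ℝ) ^ 2 ∂labelMeasure p = p := by
    rw [integral_labelMeasure hp0 hp1]; simp
  have hv : ∫ s : SignType, ((s : ℝ) ^ 2 - p) ^ 2 ∂labelMeasure p = p * (1 - p) := by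
    rw [integral_labelMeasure hp0 hp1]; simp; ring
  rw [hc, hv] at h
  exact h

end

/-! ### Linearization of the mean label -/

/-- For m > 0, S/m - S/A = (S (A - m) + (S/m) (A - m)²) / A² exactly. With |S/m| ≤ 1 and S (A - m)
split into squares, only second moments of S and m - A remain. -/
theorem abs_div_sub_div_le {S m A : ℝ} (hS : |S| ≤ m) (hA : 0 < A) :
    |S / m - S / A| ≤ (S ^ 2 / 2 + 3 / 2 * (m - A) ^ 2) / A ^ 2 := by
  rcases eq_or_lt_of_le ((abs_nonneg S).trans hS) with hm | hm
  · have : S = 0 := by rw [← hm] at hS; exact abs_eq_zero.1 (le_antisymm hS (abs_nonneg S))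
    subst this
    simp; positivity
  · have e : S / m - S / A = (S * (A - m) + S / m * (A - m) ^ 2) / A ^ 2 := by
      field_simp; ring
    rw [e, abs_div, abs_of_pos (by positivity : 0 < A ^ 2)]
    refine div_le_div_of_nonneg_right ?_ (by positivity)
    have h1 : |S / m| ≤ 1 := by rw [abs_div, abs_of_pos hm]; exact (div_le_one hm).2 hS
    calc |S * (A - m) + S / m * (A - m) ^ 2|
        ≤ |S * (A - m)| + |S / m * (A - m) ^ 2| := abs_add_le _ _
      _ ≤ (S ^ 2 / 2 + (A - m) ^ 2 / 2) + 1 * (A - m) ^ 2 := by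
          refine add_le_add ?_ ?_
          · rw [abs_le]
            constructor <;> nlinarith [sq_nonneg (S - (A - m)), sq_nonneg (S + (A - m))]
          · rw [abs_mul, abs_of_nonneg (sq_nonneg (A - m))]
            exact mul_le_mul_of_nonneg_right h1 (sq_nonneg _)
      _ = _ := by ring

/-- The mean label of the cloned records is close to the normalized sum of the other labels. -/
theorem abs_meanLabel_sub_le {n : ℕ} (i : Fin n) {A : ℝ} (hA : 0 < A) (l : Fin n → SignType) :
    |(∑ j, (l j : ℝ)) / (∑ j, (l j : ℝ) ^ 2) - othersSum i l / A| ≤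
      (othersSum i l ^ 2 + 3 * (othersCount i l - A) ^ 2 + 4) / A ^ 2 + 1 / A := by
  have hS : ∑ j, (l j : ℝ) = l i + othersSum i l :=
    (Finset.add_sum_erase _ (fun j => (l j : ℝ)) (Finset.mem_univ i)).symm
  have hm : ∑ j, (l j : ℝ) ^ 2 = (l i : ℝ) ^ 2 + othersCount i l :=
    (Finset.add_sum_erase _ (fun j => (l j : ℝ) ^ 2) (Finset.mem_univ i)).symm
  have hle : |∑ j, (l j : ℝ)| ≤ ∑ j, (l j : ℝ) ^ 2 :=
    (Finset.abs_sum_le_sum_abs _ _).trans (Finset.sum_le_sum fun j _ => abs_signType_le_sq _)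
  have h1 := abs_div_sub_div_le hle hA
  have hli := sq_signType_le_one (l i)
  have hli' : |(l i : ℝ)| ≤ 1 := (abs_signType_le_sq _).trans hli
  have h2 : |(∑ j, (l j : ℝ)) / A - othersSum i l / A| ≤ 1 / A := by
    rw [hS, ← sub_div, add_sub_cancel_right, abs_div, abs_of_pos hA]
    exact div_le_div_of_nonneg_right hli' hA.le
  refine (abs_sub_le _ ((∑ j, (l j : ℝ)) / A) _).trans (add_le_add (h1.trans ?_) h2)
  refine div_le_div_of_nonneg_right ?_ (by positivity)
  rw [hS, hm]
  have e1 : ((l i : ℝ) + othersSum i l) ^ 2 ≤ 2 * othersSum i l ^ 2 + 2 := by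
    nlinarith [sq_nonneg ((l i : ℝ) - othersSum i l)]
  have e2 : ((l i : ℝ) ^ 2 + othersCount i l - A) ^ 2 ≤ 2 * (othersCount i l - A) ^ 2 + 2 := by
    nlinarith [sq_nonneg ((l i : ℝ) ^ 2 - (othersCount i l - A)), sq_nonneg (l i : ℝ)]
  linarith

/-- The normalized sum of the labels of all records but `i`. -/
def normSum {n : ℕ} (p : ℝ) (i : Fin n) (l : Fin n → SignType) : ℝ :=
  othersSum i l / Real.sqrt (((n : ℝ) - 1) * p)

theorem integral_normSum_sq {n : ℕ} (hn : 2 ≤ n) {p : ℝ} (hp0 : 0 < p) (hp1 : p ≤ 1) (i : Fin n) :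
    ∫ l, normSum p i l ^ 2 ∂labelLaw p i = 1 := by
  have hA : 0 < ((n : ℝ) - 1) * p := by
    have : (2 : ℝ) ≤ n := by exact_mod_cast hn
    exact mul_pos (by linarith) hp0
  simp only [normSum, div_pow, Real.sq_sqrt hA.le]
  rw [integral_div, integral_othersSum_sq hp0.le hp1, div_self hA.ne']

/-- Linearizes power minus level. With A = (n - 1) p = 4/μ², the label sum and the clone count have
variance at most A, so the quadratic remainder has expectation of order 1/A, that is, of order μ².
-/
theorem abs_integral_label_mul_sub_le {n : ℕ} (hn : 2 ≤ n) {p : ℝ} (hp0 : 0 < p) (hp1 : p ≤ 1)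
    (i : Fin n) (g : (Fin n → SignType) → ℝ) (hg01 : ∀ l, g l ∈ Set.Icc (0 : ℝ) 1)
    (hg : ∀ l j, l i ≠ 0 → l j ≠ 0 → g (l ∘ Equiv.swap i j) = g l) {μ : ℝ}
    (hμ : μ = 2 / Real.sqrt (((n : ℝ) - 1) * p)) :
    |2 * ∫ l, (l i : ℝ) * g l ∂labelLaw p i - μ * ∫ l, g l * normSum p i l ∂labelLaw p i| ≤
      3 * μ ^ 2 + μ ^ 4 := by
  have := isProbabilityMeasure_labelLaw hp0.le hp1 i
  have hA : 0 < ((n : ℝ) - 1) * p := by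
    have : (2 : ℝ) ≤ n := by exact_mod_cast hn
    exact mul_pos (by linarith) hp0
  have hcount := integral_othersCount_sub_sq hp0.le hp1 i
  have hsum := integral_othersSum_sq hp0.le hp1 i
  rw [show ((n : ℝ) - 1) * (p * (1 - p)) = ((n : ℝ) - 1) * p * (1 - p) by ring] at hcount
  simp only [normSum]
  rw [integral_label_mul hp0 hp1 i g hg]
  set A := ((n : ℝ) - 1) * p
  have hsA : 0 < Real.sqrt A := Real.sqrt_pos.2 hA
  have hss : Real.sqrt A * Real.sqrt A = A := Real.mul_self_sqrt hA.le
  have hμ2 : μ ^ 2 = 4 / A := by rw [hμ, div_pow, Real.sq_sqrt hA.le]; norm_num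
  have hμ4 : μ ^ 4 = 16 / A ^ 2 := by
    rw [show μ ^ 4 = (μ ^ 2) ^ 2 by ring, hμ2, div_pow]; norm_num
  have e : 2 * ∫ l, g l * ((∑ j, (l j : ℝ)) / ∑ j, (l j : ℝ) ^ 2) ∂labelLaw p i -
      μ * ∫ l, g l * (othersSum i l / Real.sqrt A) ∂labelLaw p i =
      2 * ∫ l, g l * ((∑ j, (l j : ℝ)) / (∑ j, (l j : ℝ) ^ 2) - othersSum i l / A)
        ∂labelLaw p i := by
    rw [← integral_const_mul, ← integral_const_mul, ← integral_const_mul,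
      ← integral_sub .of_finite .of_finite]
    refine integral_congr_ae (Filter.Eventually.of_forall fun l => ?_)
    have : μ * (g l * (othersSum i l / Real.sqrt A)) = 2 * (g l * (othersSum i l / A)) := by
      calc _ = 2 * (g l * othersSum i l) / (Real.sqrt A * Real.sqrt A) := by rw [hμ]; ring
        _ = _ := by rw [hss]; ring
    simp only [this]; ring
  have hb : |∫ l, g l * ((∑ j, (l j : ℝ)) / (∑ j, (l j : ℝ) ^ 2) - othersSum i l / A)
      ∂labelLaw p i| ≤ (A + 3 * (A * (1 - p)) + 4) / A ^ 2 + 1 / A := by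
    calc _ ≤ ∫ l, |g l * ((∑ j, (l j : ℝ)) / (∑ j, (l j : ℝ) ^ 2) - othersSum i l / A)|
          ∂labelLaw p i := abs_integral_le_integral_abs
      _ ≤ ∫ l, ((othersSum i l ^ 2 + 3 * (othersCount i l - A) ^ 2 + 4) / A ^ 2 + 1 / A)
          ∂labelLaw p i := by
        refine integral_mono .of_finite .of_finite fun l => ?_
        have h1 := abs_meanLabel_sub_le i hA l
        simp only [abs_mul, abs_of_nonneg (hg01 l).1]
        exact (mul_le_of_le_one_left (abs_nonneg _) (hg01 l).2).trans h1
      _ = _ := by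
        rw [integral_add .of_finite .of_finite, integral_div, integral_add .of_finite .of_finite,
          integral_add .of_finite .of_finite, integral_const_mul, hsum, hcount]
        simp
  have hAp : 3 * (A * (1 - p)) ≤ 3 * A := by nlinarith
  have hb' : (A + 3 * (A * (1 - p)) + 4) / A ^ 2 + 1 / A ≤ 5 / A + 4 / A ^ 2 := by
    have : (A + 3 * (A * (1 - p)) + 4) / A ^ 2 ≤ (4 * A + 4) / A ^ 2 :=
      div_le_div_of_nonneg_right (by linarith) (by positivity)
    have e2 : (4 * A + 4) / A ^ 2 = 4 / A + 4 / A ^ 2 := by field_simp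
    have e3 : 5 / A = 4 / A + 1 / A := by ring
    linarith
  rw [e, abs_mul, abs_two, hμ2, hμ4]
  have p1 : 0 < 1 / A := by positivity
  have p2 : 0 < 1 / A ^ 2 := by positivity
  -- The claimed bound 3 μ² + μ⁴ is 12/A + 16/A², so the constants leave slack.
  have : 2 * (5 / A + 4 / A ^ 2) ≤ 3 * (4 / A) + 16 / A ^ 2 := by
    have e1 : 3 * (4 / A) + 16 / A ^ 2 - 2 * (5 / A + 4 / A ^ 2) =
        2 * (1 / A) + 8 * (1 / A ^ 2) := by ring
    linarith
  linarith

/-! ### The central limit theorem for the labels -/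

theorem integrable_max_sub {ν : Measure ℝ} [IsFiniteMeasure ν] (h : Integrable (fun x : ℝ => x) ν)
    (t : ℝ) : Integrable (fun x => max (x - t) 0) ν :=
  (h.sub (integrable_const t)).pos_part

/-- Under a second moment bound, weak convergence implies an upper bound for the limit of the
expectations of `(x - t)⁺`. -/
theorem eventually_integral_max_sub_le {ν : ℕ → ProbabilityMeasure ℝ} {γ : ProbabilityMeasure ℝ}
    (hν : Filter.Tendsto ν Filter.atTop (nhds γ))
    (h1 : ∀ᶠ k in Filter.atTop, MemLp (fun x : ℝ => x) 2 (ν k : Measure ℝ))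
    (h2 : ∀ᶠ k in Filter.atTop, ∫ x, x ^ 2 ∂(ν k : Measure ℝ) ≤ 1)
    (hγ : Integrable (fun x : ℝ => x) (γ : Measure ℝ)) (t : ℝ) {η : ℝ} (hη : 0 < η) :
    ∀ᶠ k in Filter.atTop, ∫ x, max (x - t) 0 ∂(ν k : Measure ℝ) ≤
      ∫ x, max (x - t) 0 ∂(γ : Measure ℝ) + η := by
  -- Weak convergence tests bounded functions only, so (x - t)⁺ is truncated at M. Beyond M it is at
  -- most (x - t)²/M ≤ (2 x² + 2 t²)/M, of expectation at most C/M, and M is chosen to make this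
  -- η/2.
  set C : ℝ := 2 + 2 * t ^ 2
  have hC : 0 < C := by positivity
  set M : ℝ := 2 * C / η
  have hM : 0 < M := by positivity
  have hCM : C / M = η / 2 := by simp only [M]; field_simp
  let f : BoundedContinuousFunction ℝ ℝ :=
    BoundedContinuousFunction.ofNormedAddCommGroup (fun x : ℝ => min (max (x - t) 0) M)
      (by fun_prop) M fun x => by
        rw [Real.norm_of_nonneg (le_min (le_max_right _ _) hM.le)]
        exact min_le_right _ _
  have hf : ∀ x, f x = min (max (x - t) 0) M := fun x => rfl
  have hlim := (ProbabilityMeasure.tendsto_iff_forall_integral_tendsto.1 hν) f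
  have hev := hlim.eventually_lt_const (show ∫ x, f x ∂(γ : Measure ℝ) <
    ∫ x, f x ∂(γ : Measure ℝ) + η / 2 by linarith)
  have hγf : ∫ x, f x ∂(γ : Measure ℝ) ≤ ∫ x, max (x - t) 0 ∂(γ : Measure ℝ) :=
    integral_mono (f.integrable _) (integrable_max_sub hγ t) fun x => min_le_left _ _
  filter_upwards [hev, h1, h2] with k hk hk1 hk2
  have hpt : ∀ x, max (x - t) 0 ≤ f x + (2 * x ^ 2 + 2 * t ^ 2) / M := by
    intro x
    rw [hf]
    rcases le_total (max (x - t) 0) M with h | h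
    · rw [min_eq_left h]
      have : 0 ≤ (2 * x ^ 2 + 2 * t ^ 2) / M := by positivity
      linarith
    · rw [min_eq_right h]
      have hx : max (x - t) 0 = x - t := by
        refine max_eq_left ?_
        by_contra hneg
        rw [max_eq_right (not_le.1 hneg).le] at h
        linarith
      rw [hx] at h ⊢
      have : x - t ≤ (2 * x ^ 2 + 2 * t ^ 2) / M := by
        rw [le_div_iff₀ hM]
        nlinarith [sq_nonneg (x + t)]
      linarith
  have hsq : Integrable (fun x : ℝ => x ^ 2) (ν k : Measure ℝ) := hk1.integrable_sq
  have hint : Integrable (fun x : ℝ => (2 * x ^ 2 + 2 * t ^ 2) / M) (ν k : Measure ℝ) :=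
    ((hsq.const_mul 2).add (integrable_const _)).div_const M
  calc ∫ x, max (x - t) 0 ∂(ν k : Measure ℝ)
      ≤ ∫ x, (f x + (2 * x ^ 2 + 2 * t ^ 2) / M) ∂(ν k : Measure ℝ) :=
        integral_mono (integrable_max_sub (hk1.integrable (by norm_num)) t)
          ((f.integrable _).add hint) hpt
    _ = ∫ x, f x ∂(ν k : Measure ℝ) + (2 * ∫ x, x ^ 2 ∂(ν k : Measure ℝ) + 2 * t ^ 2) / M := by
        rw [integral_add (f.integrable _) hint, integral_div,
          integral_add (hsq.const_mul 2) (integrable_const _), integral_const_mul]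
        simp
    _ ≤ ∫ x, f x ∂(ν k : Measure ℝ) + C / M := by
        gcongr
        simp only [C]; linarith
    _ ≤ _ := by rw [hCM]; linarith

/-- With N + 1 records, exactly N i.i.d. summands remain besides i, as the central limit theorem
requires. -/
theorem charFun_map_normSum {N : ℕ} {p : ℝ} (hp0 : 0 < p) (hp1 : p ≤ 1) (i : Fin (N + 1)) (t : ℝ) :
    charFun ((labelLaw p i).map (normSum p i)) t =
      charFun ((labelMeasure p).map fun s : SignType => (s : ℝ) / Real.sqrt p)
        ((Real.sqrt N)⁻¹ * t) ^ N := by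
  have hind := (iIndepFun_labels hp0.le hp1 i fun s => (s : ℝ) / Real.sqrt p).restrict
    (Finset.univ.erase i)
  have h := hind.charFun_map_fun_finsetSum_eq_prod fun j _ => Measurable.of_discrete.aemeasurable
  have e : normSum p i = fun l => (Real.sqrt N)⁻¹ *
      ∑ j ∈ Finset.univ.erase i, (l j : ℝ) / Real.sqrt p := by
    funext l
    have : ((N + 1 : ℕ) : ℝ) - 1 = N := by push_cast; ring
    rw [normSum, othersSum, this, Real.sqrt_mul (Nat.cast_nonneg N), ← Finset.sum_div]
    ring
  rw [e, charFun_map_mul_comp Measurable.of_discrete.aemeasurable, h, Finset.prod_apply,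
    Finset.prod_congr rfl (g := fun _ => charFun ((labelMeasure p).map
      fun s : SignType => (s : ℝ) / Real.sqrt p) ((Real.sqrt N)⁻¹ * t)) ?_]
  · simp
  · intro j hj
    rw [← map_eval_labelLaw hp0.le hp1 (Finset.ne_of_mem_erase hj), Measure.map_map
      Measurable.of_discrete Measurable.of_discrete]
    rfl

theorem isProbabilityMeasure_map_normSum {n : ℕ} {p : ℝ} (hp0 : 0 < p) (hp1 : p ≤ 1)
    (i : Fin n) : IsProbabilityMeasure ((labelLaw p i).map (normSum p i)) := by
  have := isProbabilityMeasure_labelLaw hp0.le hp1 i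
  exact Measure.isProbabilityMeasure_map Measurable.of_discrete.aemeasurable

/-- The law of the normalized sum of labels. -/
def normSumLaw {n : ℕ} {p : ℝ} (hp0 : 0 < p) (hp1 : p ≤ 1) (i : Fin n) : ProbabilityMeasure ℝ :=
  ⟨(labelLaw p i).map (normSum p i), isProbabilityMeasure_map_normSum hp0 hp1 i⟩

/-- The standard Gaussian law. -/
def stdGaussianLaw : ProbabilityMeasure ℝ := ⟨gaussianReal 0 1, inferInstance⟩

/-- The variables s/√p are centred with variance 1. The characteristic function does not involve the
distinguished record, which may therefore vary arbitrarily with N. -/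
theorem tendsto_normSumLaw {p : ℝ} (hp0 : 0 < p) (hp1 : p ≤ 1) (i : (N : ℕ) → Fin (N + 1)) :
    Filter.Tendsto (fun N => normSumLaw hp0 hp1 (i N)) Filter.atTop (nhds stdGaussianLaw) := by
  have := isProbabilityMeasure_labelMeasure hp0.le hp1
  have hsp : Real.sqrt p ^ 2 = p := Real.sq_sqrt hp0.le
  refine ProbabilityMeasure.tendsto_iff_tendsto_charFun.2 fun t => ?_
  have h := tendsto_charFun_inv_sqrt_mul_pow (P := labelMeasure p)
    (X := fun s => (s : ℝ) / Real.sqrt p) Measurable.of_discrete.aemeasurable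
    (by rw [integral_labelMeasure hp0.le hp1]; simp; ring)
    (by
      simp only [Pi.pow_apply, div_pow, hsp]
      rw [integral_labelMeasure hp0.le hp1]
      simp
      field_simp
      norm_num) t
  simpa [normSumLaw, stdGaussianLaw, charFun_map_normSum hp0 hp1, charFun_gaussianReal,
    neg_div] using h

/-- `E (Z - t)⁺` for a standard Gaussian `Z`. -/
def gaussianExcess (t : ℝ) : ℝ := ∫ x, max (x - t) 0 ∂gaussianReal 0 1

theorem integrable_id_gaussianReal : Integrable (fun x : ℝ => x) (gaussianReal 0 1) :=
  (memLp_id_gaussianReal 1).integrable le_rfl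

/-- Uniformity in i comes by contradiction: a sequence that picks a violating index whenever there
is one (and 0 otherwise) would contradict the limit theorem. -/
theorem exists_forall_integral_normSum_le {p : ℝ} (hp0 : 0 < p) (hp1 : p ≤ 1) (t : ℝ) {η : ℝ}
    (hη : 0 < η) : ∃ N₀ : ℕ, ∀ n ≥ N₀, ∀ i : Fin n,
      ∫ l, max (normSum p i l - t) 0 ∂labelLaw p i ≤ gaussianExcess t + η := by
  by_contra! hcon
  let bad : (N : ℕ) → Fin (N + 1) → Prop := fun N i =>
    gaussianExcess t + η < ∫ l, max (normSum p i l - t) 0 ∂labelLaw p i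
  classical
  let i : (N : ℕ) → Fin (N + 1) := fun N => if h : ∃ i, bad N i then h.choose else 0
  have hi : ∀ N j, bad N j → bad N (i N) := fun N j hj => by
    have h : ∃ i, bad N i := ⟨j, hj⟩
    simp only [i, dif_pos h]
    exact h.choose_spec
  have hmap : ∀ (N : ℕ) (f : ℝ → ℝ), Measurable f →
      ∫ x, f x ∂(labelLaw p (i N)).map (normSum p (i N)) =
        ∫ l, f (normSum p (i N) l) ∂labelLaw p (i N) := fun N f hf =>
    integral_map Measurable.of_discrete.aemeasurable hf.aestronglyMeasurable
  have hev := eventually_integral_max_sub_le (tendsto_normSumLaw hp0 hp1 i)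
    (Filter.Eventually.of_forall fun N => by
      have := isProbabilityMeasure_labelLaw hp0.le hp1 (i N)
      exact (memLp_map_measure_iff measurable_id.aestronglyMeasurable
        Measurable.of_discrete.aemeasurable).2
        .of_discrete)
    (by
      filter_upwards [Filter.eventually_ge_atTop 1] with N hN
      have h2 := integral_normSum_sq (by omega) hp0 hp1 (i N)
      exact ((hmap N (fun x => x ^ 2) (by fun_prop)).trans h2).le)
    integrable_id_gaussianReal t hη
  obtain ⟨N₀, hN₀⟩ := Filter.eventually_atTop.1 hev
  obtain ⟨n, hn, j, hj⟩ := hcon (N₀ + 1)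
  obtain ⟨N, rfl⟩ : ∃ N, n = N + 1 := ⟨n - 1, by omega⟩
  have h1 := hN₀ N (by omega)
  have h2 := hi N j hj
  have h3 := hmap N (fun x => max (x - t) 0) (by fun_prop)
  exact absurd (h3.symm.le.trans h1) (not_le.2 h2)

/-! ### A lower bound for the power of Gaussian tests -/

theorem integrable_sq_gaussianReal : Integrable (fun x : ℝ => x ^ 2) (gaussianReal 0 1) :=
  (memLp_id_gaussianReal 2).integrable_sq

theorem integral_sq_gaussianReal : ∫ x, x ^ 2 ∂gaussianReal 0 1 = 1 := by
  have h := variance_fun_id_gaussianReal (μ := 0) (v := 1)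
  rw [variance_eq_integral measurable_id'.aemeasurable] at h
  simpa using h

theorem exists_gaussianReal_Ioi_eq {α : ℝ} (h0 : 0 < α) (h1 : α < 1) :
    ∃ t, (gaussianReal 0 1).real (Set.Ioi t) = α := by
  have hcont : Continuous fun t => (gaussianReal 0 1).real (Set.Iic t) := by
    have hi : Integrable (gaussianPDFReal 0 1) := integrable_gaussianPDFReal 0 1
    have e : (fun t => (gaussianReal 0 1).real (Set.Iic t)) = fun t =>
        (∫ x in Set.Iic (0 : ℝ), gaussianPDFReal 0 1 x) +
          ∫ x in (0 : ℝ)..t, gaussianPDFReal 0 1 x := by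
      funext t
      rw [← intervalIntegral.integral_Iic_sub_Iic hi.integrableOn hi.integrableOn,
        add_sub_cancel, Measure.real, gaussianReal_apply_eq_integral _ one_ne_zero,
        ENNReal.toReal_ofReal (integral_nonneg fun x => gaussianPDFReal_nonneg _ _ _)]
    rw [e]
    exact continuous_const.add (intervalIntegral.continuous_primitive
      (fun a b => hi.intervalIntegrable) 0)
  have hlow := (tendsto_cdf_atBot (gaussianReal 0 1)).eventually_lt_const
    (show (0 : ℝ) < 1 - α by linarith)
  have hhigh := (tendsto_cdf_atTop (gaussianReal 0 1)).eventually_const_lt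
    (show 1 - α < (1 : ℝ) by linarith)
  obtain ⟨a, ha⟩ := hlow.exists
  obtain ⟨b, hb⟩ := hhigh.exists
  rw [cdf_eq_real] at ha hb
  obtain ⟨t, ht⟩ := mem_range_of_exists_le_of_exists_ge hcont ⟨a, ha.le⟩ ⟨b, hb.le⟩
  refine ⟨t, ?_⟩
  have := probReal_compl_eq_one_sub (μ := gaussianReal 0 1) (measurableSet_Iic (a := t))
  rw [Set.compl_Iic] at this
  simp only at ht
  rw [this, ht]; ring

theorem gaussianPDFReal_eq_mul_exp (μ x : ℝ) :
    gaussianPDFReal μ 1 x = gaussianPDFReal 0 1 x * Real.exp (μ * x - μ ^ 2 / 2) := by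
  simp only [gaussianPDFReal, NNReal.coe_one, mul_one, mul_assoc, ← Real.exp_add]
  congr 2
  ring

/-- Integrate the likelihood ratio exp(μ x - μ²/2) ≥ 1 + μ x - μ²/2 over x > t, and write x = t + (x
- t). The factor of μ is E[Z; Z > t]. -/
theorem le_gaussianReal_Ioi (μ t : ℝ) :
    (gaussianReal 0 1).real (Set.Ioi t) + μ * ((gaussianReal 0 1).real (Set.Ioi t) * t +
      gaussianExcess t) - μ ^ 2 / 2 ≤ (gaussianReal μ 1).real (Set.Ioi t) := by
  set f : ℝ → ℝ := (Set.Ioi t).indicator 1 with hf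
  have hfm : Measurable f := measurable_one.indicator measurableSet_Ioi
  have hf01 : ∀ x, f x ∈ Set.Icc (0 : ℝ) 1 := fun x => by
    by_cases h : x ∈ Set.Ioi t <;> simp [hf, h]
  have hreal : ∀ m : ℝ, ∫ x, f x ∂gaussianReal m 1 = (gaussianReal m 1).real (Set.Ioi t) :=
    fun m => integral_indicator_one measurableSet_Ioi
  have hchange : ∫ x, f x ∂gaussianReal μ 1 =
      ∫ x, Real.exp (μ * x - μ ^ 2 / 2) * f x ∂gaussianReal 0 1 := by
    rw [integral_gaussianReal_eq_integral_smul one_ne_zero,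
      integral_gaussianReal_eq_integral_smul one_ne_zero]
    refine integral_congr_ae (Filter.Eventually.of_forall fun x => ?_)
    simp only [smul_eq_mul, gaussianPDFReal_eq_mul_exp μ x, mul_assoc]
  have hexp : Integrable (fun x => Real.exp (μ * x - μ ^ 2 / 2) * f x) (gaussianReal 0 1) := by
    have h1 : Integrable (fun x => Real.exp (μ * x - μ ^ 2 / 2)) (gaussianReal 0 1) := by
      simp only [Real.exp_sub]
      exact (integrable_exp_mul_gaussianReal μ).div_const _
    refine h1.mul_bdd (c := 1) hfm.aestronglyMeasurable (Filter.Eventually.of_forall fun x => ?_)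
    rw [Real.norm_of_nonneg (hf01 x).1]; exact (hf01 x).2
  have hfi : Integrable f (gaussianReal 0 1) := integrable_test hfm hf01
  have hmax := integrable_max_sub integrable_id_gaussianReal t
  have hlow : ∫ x, ((1 + μ * t - μ ^ 2 / 2) * f x + μ * max (x - t) 0) ∂gaussianReal 0 1 ≤
      ∫ x, Real.exp (μ * x - μ ^ 2 / 2) * f x ∂gaussianReal 0 1 := by
    refine integral_mono ((hfi.const_mul _).add (hmax.const_mul _)) hexp fun x => ?_
    by_cases h : t < x
    · have e1 : f x = 1 := by simp [hf, h]
      simp only [e1, max_eq_left (sub_nonneg.2 h.le)]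
      linarith [Real.add_one_le_exp (μ * x - μ ^ 2 / 2)]
    · have e1 : f x = 0 := by simp [hf, h]
      simp [e1, not_lt.1 h]
  rw [integral_add (hfi.const_mul _) (hmax.const_mul _), integral_const_mul, integral_const_mul,
    hreal, ← hchange, hreal] at hlow
  have hle : (gaussianReal 0 1).real (Set.Ioi t) ≤ 1 := measureReal_le_one
  unfold gaussianExcess
  nlinarith [sq_nonneg μ]

theorem le_one_sub_gaussianTradeoff (μ t : ℝ) {α : ℝ}
    (hα : (gaussianReal 0 1).real (Set.Ioi t) = α) :
    α + μ * (α * t + gaussianExcess t) - μ ^ 2 / 2 ≤ 1 - gaussianTradeoff μ α := by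
  have hreal : ∀ m : ℝ, ∫ x, (Set.Ioi t).indicator 1 x ∂gaussianReal m 1 =
      (gaussianReal m 1).real (Set.Ioi t) := fun m => integral_indicator_one measurableSet_Ioi
  have h := tradeoff_le (U := gaussianReal 0 1) (V := gaussianReal μ 1) (α := α)
    (φ := (Set.Ioi t).indicator 1) (measurable_one.indicator measurableSet_Ioi)
    (fun x => by by_cases h : x ∈ Set.Ioi t <;> simp [h]) (by rw [hreal, hα])
  rw [hreal] at h
  have h2 := le_gaussianReal_Ioi μ t
  rw [hα] at h2
  unfold gaussianTradeoff
  linarith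

theorem gaussianTradeoff_le_one_sub (μ : ℝ) {α : ℝ} (hα : α ∈ Set.Icc (0 : ℝ) 1) :
    gaussianTradeoff μ α ≤ 1 - α := by
  have h := tradeoff_le (U := gaussianReal 0 1) (V := gaussianReal μ 1) (α := α)
    (φ := fun _ => α) measurable_const (fun _ => hα) (by simp)
  simpa [gaussianTradeoff] using h

theorem gaussianExcess_le_add (t t' : ℝ) : gaussianExcess t' ≤ gaussianExcess t + |t' - t| := by
  have h := integrable_max_sub integrable_id_gaussianReal
  calc gaussianExcess t' ≤ ∫ x, (max (x - t) 0 + |t' - t|) ∂gaussianReal 0 1 := by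
        refine integral_mono (h t') ((h t).add (integrable_const _)) fun x => ?_
        refine max_le ?_ (by positivity)
        linarith [le_max_left (x - t) 0, neg_abs_le (t' - t)]
    _ = _ := by
        rw [integral_add (h t) (integrable_const _)]
        simp [gaussianExcess]

theorem gaussianExcess_le {K : ℝ} (hK : 0 < K) : gaussianExcess K ≤ 1 / K := by
  calc gaussianExcess K ≤ ∫ x, x ^ 2 / K ∂gaussianReal 0 1 := by
        refine integral_mono (integrable_max_sub integrable_id_gaussianReal K)
          (integrable_sq_gaussianReal.div_const K) fun x => ?_
        refine max_le ?_ (by positivity)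
        rw [le_div_iff₀ hK]
        nlinarith [sq_nonneg (x - K), sq_nonneg K, sq_nonneg x, sq_nonneg (x - 2 * K)]
    _ = 1 / K := by rw [integral_div, integral_sq_gaussianReal]

theorem gaussianExcess_neg_le {K : ℝ} (hK : 0 < K) : gaussianExcess (-K) ≤ K + 1 / K := by
  have h := integrable_id_gaussianReal
  have h2 := integrable_sq_gaussianReal.div_const K
  have h3 : Integrable (fun x : ℝ => x + x ^ 2 / K) (gaussianReal 0 1) := h.add h2
  calc gaussianExcess (-K) ≤ ∫ x, (x + x ^ 2 / K + K) ∂gaussianReal 0 1 := by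
        refine integral_mono (integrable_max_sub h (-K)) (h3.add (integrable_const K))
          fun x => ?_
        refine max_le ?_ ?_
        · have : 0 ≤ x ^ 2 / K := by positivity
          linarith
        · have : -(x + K) ≤ x ^ 2 / K := by
            rw [le_div_iff₀ hK]
            nlinarith [sq_nonneg (x + K), sq_nonneg (x + 2 * K), sq_nonneg x]
          linarith
    _ = K + 1 / K := by
        rw [integral_add h3 (integrable_const K), integral_add h h2, integral_div,
          integral_sq_gaussianReal, integral_id_gaussianReal]
        simp; ring

/-- Chebyshev's inequality for the standard Gaussian. -/
theorem gaussianReal_real_mul_le {K : ℝ} (hK : 0 < K) {s : Set ℝ} (hs : MeasurableSet s)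
    (h : ∀ x ∈ s, K ≤ |x|) : (gaussianReal 0 1).real s * K ≤ 1 / K := by
  calc (gaussianReal 0 1).real s * K = ∫ x, s.indicator 1 x * K ∂gaussianReal 0 1 := by
        rw [integral_mul_const, integral_indicator_one hs]
    _ ≤ ∫ x, x ^ 2 / K ∂gaussianReal 0 1 := by
        refine integral_mono (((integrable_const (1 : ℝ)).indicator hs).mul_const K)
          (integrable_sq_gaussianReal.div_const K) fun x => ?_
        by_cases hx : x ∈ s
        · have h1 := h x hx
          simp only [Set.indicator_of_mem hx, Pi.one_apply, one_mul]
          rw [le_div_iff₀ hK, ← sq_abs x]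
          nlinarith
        · simp only [Set.indicator_of_notMem hx, zero_mul]
          positivity
    _ = 1 / K := by rw [integral_div, integral_sq_gaussianReal]

/-- Up to an error of smaller order than `μ`, the power of the optimal Gaussian test is attained
in the linearized dual problem, at one of finitely many thresholds. -/
theorem exists_finite_thresholds {η : ℝ} (hη : 0 < η) :
    ∃ F : Set ℝ, F.Finite ∧ ∀ μ : ℝ, 0 ≤ μ → ∀ α ∈ Set.Icc (0 : ℝ) 1, ∃ t ∈ F,
      α + μ * (α * t + gaussianExcess t) - η * μ - μ ^ 2 / 2 ≤ 1 - gaussianTradeoff μ α := by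
  -- For α within 1/K² of 0 or 1, the trivial bound `1 - gaussianTradeoff μ α ≥ α` suffices, at the
  -- threshold K or -K, with error 2/K = η. For all other α, Chebyshev places the exact quantile in
  -- [-K, K]; moving it to a point of an η/2-net costs at most η, as α t and `gaussianExcess t` are
  -- 1-Lipschitz in t.
  set K : ℝ := 2 / η
  have hK : 0 < K := by positivity
  have hKη : 1 / K + 1 / K = η := by simp only [K]; field_simp; norm_num
  obtain ⟨F, -, hFfin, hF⟩ := Metric.finite_approx_of_totallyBounded
    (isCompact_Icc (a := -K) (b := K)).totallyBounded (η / 2) (half_pos hη)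
  refine ⟨insert K (insert (-K) F), (hFfin.insert _).insert _, fun μ hμ α hα => ?_⟩
  have hsq := sq_nonneg μ
  have hG := gaussianTradeoff_le_one_sub μ hα
  by_cases h1 : α * K ≤ 1 / K
  · refine ⟨K, by simp, ?_⟩
    have : α * K + gaussianExcess K ≤ η := by linarith [gaussianExcess_le hK]
    nlinarith [mul_le_mul_of_nonneg_left this hμ]
  by_cases h2 : (1 - α) * K ≤ 1 / K
  · refine ⟨-K, by simp, ?_⟩
    have : α * -K + gaussianExcess (-K) ≤ η := by linarith [gaussianExcess_neg_le hK]
    nlinarith [mul_le_mul_of_nonneg_left this hμ]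
  have hα0 : 0 < α := lt_of_le_of_ne hα.1 fun h => h1 (by rw [← h]; simp; positivity)
  have hα1 : α < 1 := lt_of_le_of_ne hα.2 fun h => h2 (by rw [h]; simp; positivity)
  obtain ⟨t, ht⟩ := exists_gaussianReal_Ioi_eq hα0 hα1
  have htK : t ∈ Set.Icc (-K) K := by
    constructor
    · by_contra hneg
      refine h2 ?_
      have hc := probReal_compl_eq_one_sub (μ := gaussianReal 0 1) (measurableSet_Ioi (a := t))
      rw [Set.compl_Ioi, ht] at hc
      rw [← hc]
      refine gaussianReal_real_mul_le hK measurableSet_Iic fun x hx => ?_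
      rw [Set.mem_Iic] at hx
      rw [abs_of_neg (by linarith)]; linarith
    · by_contra hneg
      refine h1 ?_
      rw [← ht]
      refine gaussianReal_real_mul_le hK measurableSet_Ioi fun x hx => ?_
      rw [Set.mem_Ioi] at hx
      rw [abs_of_pos (by linarith)]; linarith
  obtain ⟨t', ht', hdist⟩ := Set.mem_iUnion₂.1 (hF htK)
  rw [Metric.mem_ball, Real.dist_eq, abs_sub_comm] at hdist
  refine ⟨t', by simp [ht'], ?_⟩
  have hle := le_one_sub_gaussianTradeoff μ t ht
  have h3 : α * t' + gaussianExcess t' ≤ α * t + gaussianExcess t + η := by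
    have := gaussianExcess_le_add t t'
    nlinarith [le_abs_self (t' - t), abs_nonneg (t' - t)]
  nlinarith [mul_le_mul_of_nonneg_left h3 hμ]

/-! ### Asymptotic Gaussian differential privacy of the shuffled process -/

/-- The exchangeable tests for the labels have, up to `d`, at most the power of the optimal test of
`N(0, 1)` against `N(μ, 1)`. -/
def LabelPowerBound (p μ : ℝ) (n : ℕ) (d : ℝ) : Prop :=
  ∀ (i : Fin n) (g : (Fin n → SignType) → ℝ), (∀ l, g l ∈ Set.Icc (0 : ℝ) 1) →
    (∀ l j, l i ≠ 0 → l j ≠ 0 → g (l ∘ Equiv.swap i j) = g l) →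
    ∀ α ∈ Set.Icc (0 : ℝ) 1, ∫ l, (1 - (l i : ℝ)) * g l ∂labelLaw p i = α →
      ∫ l, (1 + (l i : ℝ)) * g l ∂labelLaw p i ≤ 1 - gaussianTradeoff μ α + d

/-- A crude bound from 1 + l i ≤ 2; it makes the infimum in `shuffleError` one over a nonempty set.
-/
theorem labelPowerBound_two {p : ℝ} (hp0 : 0 ≤ p) (hp1 : p ≤ 1) (μ : ℝ) (n : ℕ) :
    LabelPowerBound p μ n 2 := by
  intro i g hg01 _ α hα _
  have := isProbabilityMeasure_labelLaw hp0 hp1 i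
  have h1 : ∫ l, (1 + (l i : ℝ)) * g l ∂labelLaw p i ≤ ∫ _, (2 : ℝ) ∂labelLaw p i := by
    refine integral_mono .of_finite .of_finite fun l => ?_
    have h := abs_le.1 ((abs_signType_le_sq (l i)).trans (sq_signType_le_one _))
    have := hg01 l
    nlinarith [this.1, this.2, h.1, h.2]
  have h2 := gaussianTradeoff_le_one_sub μ hα
  simp only [integral_const, probReal_univ, one_smul] at h1
  linarith [hα.1]

/-- Weak duality: g W ≤ g t + (W - t)⁺ for 0 ≤ g ≤ 1. The mean of g exceeds the level α by x/2, half
the difference x of power and level. As x is of order μ and enters multiplied by μ t, this only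
costs second order. -/
theorem integral_label_test_le {n : ℕ} (hn : 2 ≤ n) {p : ℝ} (hp0 : 0 < p) (hp1 : p ≤ 1)
    (i : Fin n) (g : (Fin n → SignType) → ℝ) (hg01 : ∀ l, g l ∈ Set.Icc (0 : ℝ) 1)
    (hg : ∀ l j, l i ≠ 0 → l j ≠ 0 → g (l ∘ Equiv.swap i j) = g l) {μ : ℝ}
    (hμ : μ = 2 / Real.sqrt (((n : ℝ) - 1) * p)) {α : ℝ}
    (hα : ∫ l, (1 - (l i : ℝ)) * g l ∂labelLaw p i = α) (t : ℝ) :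
    ∫ l, (1 + (l i : ℝ)) * g l ∂labelLaw p i ≤
      α + μ * (α * t + ∫ l, max (normSum p i l - t) 0 ∂labelLaw p i) +
        μ * (|t| * (μ + 3 * μ ^ 2 + μ ^ 4) / 2 + (3 * μ + μ ^ 3)) := by
  have := isProbabilityMeasure_labelLaw hp0.le hp1 i
  have hμ0 : 0 ≤ μ := by rw [hμ]; positivity
  set P := labelLaw p i
  set x := 2 * ∫ l, (l i : ℝ) * g l ∂P with hx
  have habs := abs_le.1 (abs_integral_label_mul_sub_le hn hp0 hp1 i g hg01 hg hμ)
  rw [← hx] at habs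
  have e0 : ∫ l, (1 - (l i : ℝ)) * g l ∂P = ∫ l, g l ∂P - x / 2 := by
    rw [hx, mul_div_cancel_left₀ _ two_ne_zero, ← integral_sub .of_finite .of_finite]
    congr 1; funext l; ring
  have e1 : ∫ l, (1 + (l i : ℝ)) * g l ∂P = ∫ l, g l ∂P + x / 2 := by
    rw [hx, mul_div_cancel_left₀ _ two_ne_zero, ← integral_add .of_finite .of_finite]
    congr 1; funext l; ring
  have hW : |∫ l, g l * normSum p i l ∂P| ≤ 1 := by
    calc _ ≤ ∫ l, |g l * normSum p i l| ∂P := abs_integral_le_integral_abs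
      _ ≤ ∫ l, (1 / 2 + normSum p i l ^ 2 / 2) ∂P := by
        refine integral_mono .of_finite .of_finite fun l => ?_
        simp only [abs_mul, abs_of_nonneg (hg01 l).1]
        refine (mul_le_of_le_one_left (abs_nonneg _) (hg01 l).2).trans ?_
        rw [← sq_abs (normSum p i l)]
        nlinarith [sq_nonneg (|normSum p i l| - 1)]
      _ = 1 := by
        rw [integral_add .of_finite .of_finite, integral_div, integral_div,
          (integral_normSum_sq hn hp0 hp1 i : ∫ l, normSum p i l ^ 2 ∂P = 1)]
        simp; norm_num
  have hxabs : |x| ≤ μ + 3 * μ ^ 2 + μ ^ 4 := by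
    have := abs_le.1 hW
    rw [abs_le]; constructor <;> nlinarith [this.1, this.2]
  have hdual : ∫ l, g l * normSum p i l ∂P ≤
      (∫ l, g l ∂P) * t + ∫ l, max (normSum p i l - t) 0 ∂P := by
    rw [← integral_mul_const, ← integral_add .of_finite .of_finite]
    refine integral_mono .of_finite .of_finite fun l => ?_
    have h1 := hg01 l
    have h2 := le_max_left (normSum p i l - t) 0
    have h3 := le_max_right (normSum p i l - t) 0
    simp only
    nlinarith [h1.1, h1.2, mul_le_mul_of_nonneg_left h2 h1.1, mul_le_of_le_one_left h3 h1.2]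
  have hmean : ∫ l, g l ∂P = α + x / 2 := by linarith
  have hxt : x * t ≤ |t| * (μ + 3 * μ ^ 2 + μ ^ 4) := by
    calc x * t ≤ |x * t| := le_abs_self _
      _ = |t| * |x| := by rw [abs_mul, mul_comm]
      _ ≤ _ := mul_le_mul_of_nonneg_left hxabs (abs_nonneg t)
  have hfin : ∫ l, g l * normSum p i l ∂P ≤ α * t + |t| * (μ + 3 * μ ^ 2 + μ ^ 4) / 2 +
      ∫ l, max (normSum p i l - t) 0 ∂P := by
    rw [hmean] at hdual
    linarith
  rw [e1, hmean]
  have := mul_le_mul_of_nonneg_left hfin hμ0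
  nlinarith [habs.2]

theorem gdpParam_eq (ε : ℝ) (n : ℕ) :
    gdpParam ε n = 2 / Real.sqrt (((n : ℝ) - 1) * Real.exp (-ε)) := by
  rw [gdpParam, Real.sqrt_mul' _ (Real.exp_pos _).le, ← Real.exp_half, neg_div, Real.exp_neg]
  field_simp

theorem gdpParam_nonneg (ε : ℝ) (n : ℕ) : 0 ≤ gdpParam ε n := by
  unfold gdpParam; positivity

theorem tendsto_gdpParam (ε : ℝ) : Filter.Tendsto (gdpParam ε) Filter.atTop (nhds 0) := by
  unfold gdpParam
  refine Filter.Tendsto.div_atTop tendsto_const_nhds (Real.tendsto_sqrt_atTop.comp ?_)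
  exact Filter.tendsto_atTop_add_const_right _ _ tendsto_natCast_atTop_atTop

/-- Three errors of η/3 relative to μ_n: restriction to finitely many thresholds, the central limit
theorem at each of them, and the terms of second order in μ_n. Finiteness of `F` allows one n for
all thresholds, hence for all α. -/
theorem eventually_labelPowerBound {ε : ℝ} (hε : 0 < ε) {η : ℝ} (hη : 0 < η) :
    ∀ᶠ n in Filter.atTop,
      LabelPowerBound (Real.exp (-ε)) (gdpParam ε n) n (η * gdpParam ε n) := by
  have hp0 : 0 < Real.exp (-ε) := Real.exp_pos _
  have hp1 : Real.exp (-ε) ≤ 1 := Real.exp_le_one_iff.2 (by linarith)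
  obtain ⟨F, hFfin, hF⟩ := exists_finite_thresholds (show 0 < η / 3 by positivity)
  have hex : ∀ᶠ n in Filter.atTop, ∀ t ∈ F, ∀ i : Fin n,
      ∫ l, max (normSum (Real.exp (-ε)) i l - t) 0 ∂labelLaw (Real.exp (-ε)) i ≤
        gaussianExcess t + η / 3 := by
    rw [Filter.eventually_all_finite hFfin]
    intro t _
    obtain ⟨N₀, h⟩ := exists_forall_integral_normSum_le hp0 hp1 t (show 0 < η / 3 by positivity)
    exact Filter.eventually_atTop.2 ⟨N₀, h⟩
  have hsmall : ∀ᶠ n in Filter.atTop, ∀ t ∈ F,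
      |t| * (gdpParam ε n + 3 * gdpParam ε n ^ 2 + gdpParam ε n ^ 4) / 2 +
        (3 * gdpParam ε n + gdpParam ε n ^ 3) + gdpParam ε n / 2 < η / 3 := by
    rw [Filter.eventually_all_finite hFfin]
    intro t _
    have hc : Continuous fun μ : ℝ =>
        |t| * (μ + 3 * μ ^ 2 + μ ^ 4) / 2 + (3 * μ + μ ^ 3) + μ / 2 := by fun_prop
    have := (hc.tendsto 0).comp (tendsto_gdpParam ε)
    refine this.eventually_lt_const ?_
    simp; positivity
  filter_upwards [hex, hsmall, Filter.eventually_ge_atTop 2] with n h1 h2 hn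
  intro i g hg01 hg α hα hint
  obtain ⟨t, htF, ht⟩ := hF _ (gdpParam_nonneg ε n) α hα
  have hle := integral_label_test_le hn hp0 hp1 i g hg01 hg (gdpParam_eq ε n) hint t
  have hμ0 := gdpParam_nonneg ε n
  have a1 := mul_le_mul_of_nonneg_left (h1 t htF i) hμ0
  have a2 := mul_le_mul_of_nonneg_left (h2 t htF).le hμ0
  nlinarith

/-- The smallest error for which the power of exchangeable tests for the labels is bounded by the
Gaussian power. -/
def shuffleError (ε : ℝ) (n : ℕ) : ℝ :=
  sInf {d : ℝ | 0 ≤ d ∧ LabelPowerBound (Real.exp (-ε)) (gdpParam ε n) n d}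

theorem shuffleError_isLittleO {ε : ℝ} (hε : 0 < ε) :
    shuffleError ε =o[Filter.atTop] fun n => gdpParam ε n := by
  rw [Asymptotics.isLittleO_iff]
  intro η hη
  filter_upwards [eventually_labelPowerBound hε hη] with n hn
  have hμ0 := gdpParam_nonneg ε n
  have h0 : 0 ≤ shuffleError ε n := Real.sInf_nonneg fun d hd => hd.1
  rw [Real.norm_of_nonneg h0, Real.norm_of_nonneg hμ0]
  exact csInf_le ⟨0, fun d hd => hd.1⟩ ⟨by positivity, hn⟩

/-- The infimum is attained, since every constraint is a non-strict lower bound on d. -/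
theorem labelPowerBound_shuffleError {ε : ℝ} (hε : 0 < ε) (n : ℕ) :
    LabelPowerBound (Real.exp (-ε)) (gdpParam ε n) n (shuffleError ε n) := by
  intro i g hg01 hg α hα hint
  rw [← sub_le_iff_le_add']
  exact le_csInf ⟨2, by norm_num, labelPowerBound_two (Real.exp_pos _).le
    (Real.exp_le_one_iff.2 (by linarith)) _ _⟩
    fun d hd => sub_le_iff_le_add'.2 (hd.2 i g hg01 hg α hα hint)

theorem isGDPUpTo_shuffledLaw {ε : ℝ} (hε : 0 < ε) {n : ℕ} {D : Type u} {S : ℕ → Type v}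
    [∀ i, MeasurableSpace (S i)] (R : (i : ℕ) → D → Kernel ((j : Fin i) → S j) (S i))
    [∀ i x, IsMarkovKernel (R i x)] (hR : IsLDPProcess ε n R) :
    IsGDPUpTo (shuffledLaw R n) (gdpParam ε n) (shuffleError ε n) := by
  rintro X₀ X₁ ⟨i, -, hX⟩ α hα
  refine le_tradeoff hα.1 fun φ hφ h01 hle => ?_
  have hldp : ∀ k < n, ∀ z x x' E, MeasurableSet E →
      ENNReal.ofReal (Real.exp (-ε)) * R k x z E ≤ R k x' z E := by
    intro k hk z x x' E hE
    calc ENNReal.ofReal (Real.exp (-ε)) * R k x z E ≤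
          ENNReal.ofReal (Real.exp (-ε)) * (ENNReal.ofReal (Real.exp ε) * R k x' z E) :=
        mul_le_mul_right (hR k hk z x x' E hE) _
      _ = R k x' z E := by
        rw [← mul_assoc, ← ENNReal.ofReal_mul (Real.exp_pos _).le, ← Real.exp_add]
        simp
  obtain ⟨g, hg01, hg, h0, h1⟩ := exists_label_test (Real.exp_pos (-ε))
    (by simpa using hε) R hldp X₀ X₁ i hX φ hφ h01
  have hmem := integral_test_mem_Icc (U := shuffledLaw R n X₀) hφ h01
  have hb := labelPowerBound_shuffleError hε n i g hg01 hg _ hmem h0.symm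
  rw [← h1] at hb
  -- `LabelPowerBound` concerns the exact level of a test, which may be below α; monotonicity of the
  -- Gaussian trade-off function closes the gap.
  have hanti : gaussianTradeoff (gdpParam ε n) α ≤
      gaussianTradeoff (gdpParam ε n) (∫ z, φ z ∂shuffledLaw R n X₀) :=
    tradeoff_antitone hmem.1 hle
  linarith

/-! ### Bivariate Gaussians with a common covariance matrix -/

/-- A Gaussian with covariance matrix `v vᵀ + v' v'ᵀ` as the image of a product of Gaussians. -/
theorem multivariateGaussian_eq_map_prod {ι : Type*} [Fintype ι] [DecidableEq ι]
    (m v v' : EuclideanSpace ℝ ι) (a : ℝ) :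
    multivariateGaussian (m + a • v)
        (Matrix.vecMulVec v.ofLp v.ofLp + Matrix.vecMulVec v'.ofLp v'.ofLp) =
      ((gaussianReal a 1).prod (gaussianReal 0 1)).map (fun q => m + q.1 • v + q.2 • v') := by
  have hf : Measurable fun q : ℝ × ℝ => m + q.1 • v + q.2 • v' := by fun_prop
  have := Measure.isProbabilityMeasure_map (μ := (gaussianReal a 1).prod (gaussianReal 0 1))
    hf.aemeasurable
  have hS : (Matrix.vecMulVec v.ofLp v.ofLp + Matrix.vecMulVec v'.ofLp v'.ofLp).PosSemidef := by
    have h1 := Matrix.posSemidef_vecMulVec_self_star v.ofLp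
    have h2 := Matrix.posSemidef_vecMulVec_self_star v'.ofLp
    simp only [star_trivial] at h1 h2
    exact h1.add h2
  refine Measure.ext_of_charFun (funext fun s => ?_)
  rw [charFun_multivariateGaussian hS, charFun_apply, integral_map hf.aemeasurable (by fun_prop)]
  have hpt : ∀ q : ℝ × ℝ, Complex.exp ((inner ℝ (m + q.1 • v + q.2 • v') s : ℝ) * Complex.I) =
      Complex.exp ((inner ℝ s m : ℝ) * Complex.I) *
        (Complex.exp ((inner ℝ s v : ℝ) * (q.1 : ℂ) * Complex.I) *
          Complex.exp ((inner ℝ s v' : ℝ) * (q.2 : ℂ) * Complex.I)) := by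
    intro q
    rw [← Complex.exp_add, ← Complex.exp_add, real_inner_comm, inner_add_right, inner_add_right,
      inner_smul_right, inner_smul_right]
    congr 1
    push_cast
    ring
  simp only [hpt]
  rw [integral_const_mul, integral_prod_mul
    (fun x : ℝ => Complex.exp ((inner ℝ s v : ℝ) * (x : ℂ) * Complex.I))
    (fun y : ℝ => Complex.exp ((inner ℝ s v' : ℝ) * (y : ℂ) * Complex.I)),
    ← charFun_apply_real, ← charFun_apply_real, charFun_gaussianReal, charFun_gaussianReal,
    ← Complex.exp_add, ← Complex.exp_add]
  have hq : ∀ w : EuclideanSpace ℝ ι,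
      s.ofLp ⬝ᵥ (Matrix.vecMulVec w.ofLp w.ofLp).mulVec s.ofLp = (inner ℝ s w : ℝ) ^ 2 := by
    intro w
    have h1 : (inner ℝ s w : ℝ) = w.ofLp ⬝ᵥ s.ofLp := by
      simp [PiLp.inner_apply, dotProduct, mul_comm]
    rw [Matrix.vecMulVec_mulVec, h1]
    simp [dotProduct_smul, dotProduct_comm, sq]
  rw [Matrix.add_mulVec, dotProduct_add, hq, hq, inner_add_right, inner_smul_right]
  congr 1
  push_cast
  ring

/-- The optimal test of two Gaussians whose means differ in a direction `v` orthogonal to the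
remaining noise. -/
theorem tradeoff_multivariateGaussian {ι : Type*} [Fintype ι] [DecidableEq ι]
    (m v v' : EuclideanSpace ℝ ι) (hv : v ≠ 0) (hvv' : inner ℝ v v' = 0) (μ : ℝ)
    {S : Matrix ι ι ℝ}
    (hS : S = Matrix.vecMulVec v.ofLp v.ofLp + Matrix.vecMulVec v'.ofLp v'.ofLp) {α : ℝ}
    (hα : 0 ≤ α) :
    tradeoff (multivariateGaussian m S) (multivariateGaussian (m + μ • v) S) α =
      gaussianTradeoff μ α := by
  have h0 : multivariateGaussian m S =
      ((gaussianReal 0 1).prod (gaussianReal 0 1)).map (fun q => m + q.1 • v + q.2 • v') := by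
    rw [← multivariateGaussian_eq_map_prod, hS, zero_smul, add_zero]
  have h1 : multivariateGaussian (m + μ • v) S =
      ((gaussianReal μ 1).prod (gaussianReal 0 1)).map (fun q => m + q.1 • v + q.2 • v') := by
    rw [← multivariateGaussian_eq_map_prod, hS]
  have hf : Measurable fun q : ℝ × ℝ => m + q.1 • v + q.2 • v' := by fun_prop
  have hvv : (inner ℝ v v : ℝ) ≠ 0 := by simpa using hv
  apply le_antisymm
  -- By orthogonality `L` recovers the first Gaussian factor, and discarding the rest cannot help a
  -- test. Conversely, the bivariate law arises from that factor by adding independent noise and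
  -- applying a map.
  · set L : EuclideanSpace ℝ ι → ℝ := fun z => inner ℝ v (z - m) / inner ℝ v v with hL
    have hLm : Measurable L := by fun_prop
    have hLf : L ∘ (fun q : ℝ × ℝ => m + q.1 • v + q.2 • v') = Prod.fst := by
      funext q
      simp only [hL, Function.comp]
      rw [add_assoc, add_sub_cancel_left, inner_add_right, inner_smul_right, inner_smul_right,
        hvv', mul_zero, add_zero, mul_div_cancel_right₀ _ hvv]
    have hmap : ∀ a : ℝ, (((gaussianReal a 1).prod (gaussianReal 0 1)).map
        (fun q => m + q.1 • v + q.2 • v')).map L = gaussianReal a 1 := fun a => by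
      rw [Measure.map_map hLm hf, hLf, Measure.map_fst_prod]; simp
    have h := tradeoff_le_tradeoff_map (U := multivariateGaussian m S)
      (V := multivariateGaussian (m + μ • v) S) hLm hα
    rw [h0, h1, hmap, hmap] at h
    rw [h0, h1]
    exact h
  · rw [h0, h1]
    exact (tradeoff_le_tradeoff_prod (gaussianReal 0 1) hα).trans
      (tradeoff_le_tradeoff_map hf hα)

/-- The mean difference (-1, 1) is an eigenvector of the covariance matrix with eigenvalue (n - 1) p
/ 2, so the inverse matrix need not be computed. -/
theorem mahalanobis_covMat {p : ℝ} (hp0 : 0 < p) (hp1 : p < 1) {n : ℕ} (hn : 2 ≤ n) :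
    mahalanobis (covMat p n) (mean₀ p n) (mean₁ p n) = 2 / Real.sqrt (((n : ℝ) - 1) * p) := by
  have hn1 : 0 < (n : ℝ) - 1 := by
    have : (2 : ℝ) ≤ n := by exact_mod_cast hn
    linarith
  have hd : (mean₁ p n - mean₀ p n).ofLp = ![-1, 1] := by
    ext j; fin_cases j <;> simp [mean₀, mean₁]
  have hdet : IsUnit (covMat p n).det := by
    rw [isUnit_iff_ne_zero, covMat, Matrix.det_smul, Matrix.det_fin_two_of]
    have : p / 2 * (1 - p / 2) * (p / 2 * (1 - p / 2)) - -(p ^ 2 / 4) * -(p ^ 2 / 4) =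
        p ^ 2 / 4 * (1 - p) := by ring
    rw [this]
    have : 0 < 1 - p := by linarith
    positivity
  have hinv : (covMat p n)⁻¹.mulVec ![-1, 1] = (2 / (((n : ℝ) - 1) * p)) • ![-1, 1] := by
    have h : (covMat p n).mulVec ((2 / (((n : ℝ) - 1) * p)) • ![-1, 1]) = ![-1, 1] := by
      ext j
      fin_cases j <;> simp [covMat, Matrix.mulVec, dotProduct, Fin.sum_univ_two] <;> field_simp <;>
        ring
    conv_lhs => rw [← h]
    rw [Matrix.mulVec_mulVec, Matrix.nonsing_inv_mul _ hdet, Matrix.one_mulVec]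
  rw [mahalanobis, hd, hinv, dotProduct_smul]
  have : (![-1, 1] : Fin 2 → ℝ) ⬝ᵥ ![-1, 1] = 2 := by
    simp [dotProduct, Fin.sum_univ_two]; norm_num
  rw [this, smul_eq_mul, div_mul_eq_mul_div, Real.sqrt_div (by norm_num)]
  norm_num

/-- Spectral decomposition of the covariance matrix with v = μ⁻¹ (-1, 1) and v' = c (1, 1). The mean
difference is then exactly μ v, and c² is half the eigenvalue (n - 1) p (1 - p) / 2 of (1, 1),
because (1, 1) has squared length 2. -/
theorem tradeoff_covMat {p : ℝ} (hp0 : 0 < p) (hp1 : p < 1) {n : ℕ} (hn : 2 ≤ n) {μ : ℝ}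
    (hμ : μ = 2 / Real.sqrt (((n : ℝ) - 1) * p)) {α : ℝ} (hα : 0 ≤ α) :
    tradeoff (multivariateGaussian (mean₀ p n) (covMat p n))
      (multivariateGaussian (mean₁ p n) (covMat p n)) α = gaussianTradeoff μ α := by
  have hn1 : 0 < (n : ℝ) - 1 := by
    have : (2 : ℝ) ≤ n := by exact_mod_cast hn
    linarith
  have hA : 0 < ((n : ℝ) - 1) * p := mul_pos hn1 hp0
  have hμ0 : μ ≠ 0 := by rw [hμ]; positivity
  have hμ2 : μ⁻¹ * μ⁻¹ = ((n : ℝ) - 1) * p / 4 := by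
    rw [hμ, inv_div, ← sq, div_pow, Real.sq_sqrt hA.le]; norm_num
  set c : ℝ := Real.sqrt (((n : ℝ) - 1) * p * (1 - p) / 4)
  have hc : c * c = ((n : ℝ) - 1) * p * (1 - p) / 4 :=
    Real.mul_self_sqrt (by have := mul_pos hA (sub_pos.2 hp1); positivity)
  have hmean : mean₁ p n = mean₀ p n + μ • !₂[-μ⁻¹, μ⁻¹] := by
    ext j; fin_cases j <;> simp [mean₀, mean₁, hμ0]
  rw [hmean]
  refine tradeoff_multivariateGaussian _ _ !₂[c, c] ?_ ?_ μ ?_ hα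
  · intro h
    have := congrArg (fun w : EuclideanSpace ℝ (Fin 2) => w 1) h
    simp [hμ0] at this
  · simp [PiLp.inner_apply, Fin.sum_univ_two]
  · ext j k
    fin_cases j <;> fin_cases k <;>
      simp [covMat, hμ2, hc] <;> ring

end ShuffleDP

end

theorem theorem2 (ε₀ : ℝ) (hε₀ : 0 < ε₀) :
    (∃ δ : ℕ → ℝ,
      δ =o[Filter.atTop] (fun n => ShuffleDP.gdpParam ε₀ n) ∧
      ∀ n : ℕ, 2 ≤ n →
        ∀ (D : Type u) (S : ℕ → Type v) [∀ i, MeasurableSpace (S i)]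
          (R : (i : ℕ) → D → ProbabilityTheory.Kernel ((j : Fin i) → S j) (S i))
          [∀ i x, ProbabilityTheory.IsMarkovKernel (R i x)],
          ShuffleDP.IsLDPProcess ε₀ n R →
            ShuffleDP.IsGDPUpTo (ShuffleDP.shuffledLaw R n) (ShuffleDP.gdpParam ε₀ n) (δ n)) ∧
    (∀ n : ℕ, 2 ≤ n →
      ShuffleDP.mahalanobis (ShuffleDP.covMat (Real.exp (-ε₀)) n)
          (ShuffleDP.mean₀ (Real.exp (-ε₀)) n) (ShuffleDP.mean₁ (Real.exp (-ε₀)) n)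
        = 2 / Real.sqrt (((n : ℝ) - 1) * Real.exp (-ε₀)) ∧
      ∀ α ∈ Set.Icc (0 : ℝ) 1,
        ShuffleDP.tradeoff
            (ProbabilityTheory.multivariateGaussian (ShuffleDP.mean₀ (Real.exp (-ε₀)) n)
              (ShuffleDP.covMat (Real.exp (-ε₀)) n))
            (ProbabilityTheory.multivariateGaussian (ShuffleDP.mean₁ (Real.exp (-ε₀)) n)
              (ShuffleDP.covMat (Real.exp (-ε₀)) n)) α
          = ShuffleDP.gaussianTradeoff (ShuffleDP.gdpParam ε₀ n) α) := by
  have hp1 : Real.exp (-ε₀) < 1 := by simpa using hε₀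
  refine ⟨⟨ShuffleDP.shuffleError ε₀, ShuffleDP.shuffleError_isLittleO hε₀, ?_⟩,
    fun n hn => ⟨?_, ?_⟩⟩
  · intro n _ D S _ R _ hR
    exact ShuffleDP.isGDPUpTo_shuffledLaw hε₀ R hR
  · exact ShuffleDP.mahalanobis_covMat (Real.exp_pos _) hp1 hn
  · intro α hα
    exact ShuffleDP.tradeoff_covMat (Real.exp_pos _) hp1 hn (ShuffleDP.gdpParam_eq ε₀ n) hα.1
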